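/- All graphs $\Gamma=(V,E)$ are finite connected simplicial complexes of dimension $1$ all of whose vertices have valence at least $2$. Choose an orientation of each edge of $\Gamma$; then $H_1(\Gamma,\mathbb R)$ (resp. $H_1(\Gamma,\mathbb Z)$) is the space (resp. group) of real (resp. integral) simplicial $1$-cycles, contained in the space of $1$-chains $\{\sum_{e\in E} a_e\, e\}$, and the first Betti number of $\Gamma$ is $b=\dim H_1(\Gamma,\mathbb R)$. A weighted graph $(\Gamma,w)$ is a graph $\Gamma$ with a function $w:E\to[0,\infty)$ such that $\langle \sum_e a_e\,e,\sum_e a'_e\,e\rangle_w=\sum_{e} w(e)\,a_e a'_e$ is positive definite on $H_1(\Gamma,\mathbb R)$ (weights equal to zero are allowed as long as no nonzero cycle has length zero). Its Jacobian is the lattice $\Lambda(\Gamma,w)=H_1(\Gamma,\mathbb Z)\subset (H_1(\Gamma,\mathbb R),\langle\cdot,\cdot\rangle_w)$. For a lattice $\Lambda$ in a Euclidean space of dimension $n\ge 1$ let $\|\Lambda\|=\min\{\langle\lambda,\lambda\rangle:\lambda\in\Lambda\setminus\{0\}\}$, let $\det\Lambda$ be the square of the volume of a fundamental domain of $\Lambda$,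 and let $\mu(\Lambda)=\|\Lambda\|/(\det\Lambda)^{1/n}$ be its Hermite invariant. For $b\ge 1$ put $$\rho_b=\sup\{\mu(\Lambda(\Gamma,w)) : (\Gamma,w)\text{ a weighted graph of first Betti number } b\}.$$ Then for every $b\ge1$ this supremum is taken over a nonempty bounded set, so that $\rho_b$ is a well-defined real number, and as $b\to\infty$ $$\frac{1}{6e}\log_2 b\;\lesssim\;\rho_b\;\lesssim\;4\log_2\!\Big(\frac83\,b\Big),$$ where $f(b)\lesssim g(b)$ means that for every $\varepsilon>0$ one has $f(b)\le(1+\varepsilon)\,g(b)$ for all sufficiently large $b$. -/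

import Mathlib

open Filter MeasureTheory

noncomputable section

/-! ### Lattices in Euclidean spaces -/

/-- `‖Λ‖`, the least value of `⟨x, x⟩` over the nonzero vectors `x` of `Λ`. -/
def latticeMinNorm {E : Type*} [NormedAddCommGroup E] [InnerProductSpace ℝ E]
    (L : Submodule ℤ E) : ℝ :=
  sInf {r : ℝ | ∃ x ∈ L, x ≠ 0 ∧ r = inner ℝ x x}

/-- `det Λ`, the square of the Euclidean volume of a fundamental domain of `Λ`. -/
def latticeDet {E : Type*} [NormedAddCommGroup E] [InnerProductSpace ℝ E] [FiniteDimensional ℝ E]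
    [MeasurableSpace E] [BorelSpace E] (L : Submodule ℤ E) : ℝ :=
  ZLattice.covolume L volume ^ 2

/-- The Hermite invariant `μ(Λ) = ‖Λ‖ / det(Λ)^(1/n)` of a lattice of the Euclidean space `E`,
where `n = dim E`. -/
def hermiteInvariant {E : Type*} [NormedAddCommGroup E] [InnerProductSpace ℝ E]
    [FiniteDimensional ℝ E] [MeasurableSpace E] [BorelSpace E] (L : Submodule ℤ E) : ℝ :=
  latticeMinNorm L / latticeDet L ^ (1 / (Module.finrank ℝ E : ℝ))

/-! ### Graphs and their homology -/

/-- A finite connected graph (a simplicial complex of dimension 1) whose vertices all have valence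
at least 2, together with an arbitrary orientation of each of its edges. -/
structure OrientedGraph where
  V : Type
  [fintypeV : Fintype V]
  [decidableEqV : DecidableEq V]
  G : SimpleGraph V
  [decidableAdj : DecidableRel G.Adj]
  connected : G.Connected
  two_le_degree : ∀ v, 2 ≤ G.degree v
  tail : G.edgeSet → V
  head : G.edgeSet → V
  edge_eq : ∀ e : G.edgeSet, e.1 = s(tail e, head e)

namespace OrientedGraph

attribute [instance] fintypeV decidableEqV decidableAdj

/-- The (unoriented) edges. -/
abbrev Edge (Γ : OrientedGraph) : Type := Γ.G.edgeSet

/-- The simplicial boundary operator `∂ e = head e - tail e`, from the 1-chains to the 0-chains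
with coefficients in `R`. -/
def boundary (Γ : OrientedGraph) (R : Type) [CommRing R] :
    (Γ.Edge → R) →ₗ[R] (Γ.V → R) :=
  ∑ e : Γ.Edge, (LinearMap.proj e).smulRight
    (Pi.single (Γ.head e) (1 : R) - Pi.single (Γ.tail e) (1 : R))

/-- `H₁(Γ, R)`, the space of 1-cycles (there are no 2-simplices, hence no 1-boundaries). -/
def homology (Γ : OrientedGraph) (R : Type) [CommRing R] : Submodule R (Γ.Edge → R) :=
  LinearMap.ker (Γ.boundary R)

/-- The first Betti number `b₁(Γ) = dim H₁(Γ, ℝ)`. -/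
def betti (Γ : OrientedGraph) : ℕ := Module.finrank ℝ (Γ.homology ℝ)

end OrientedGraph

/-! ### Weighted graphs and their Jacobians -/

/-- A weighted graph: the edges carry nonnegative weights, such that the bilinear form
`⟨x, y⟩_w = ∑ w(e) x(e) y(e)` is a scalar product on `H₁(Γ, ℝ)`. Edges of weight zero are
allowed, but no nonzero cycle has length zero. -/
structure WeightedGraph extends OrientedGraph where
  w : toOrientedGraph.Edge → ℝ
  w_nonneg : ∀ e, 0 ≤ w e
  form_pos : ∀ x ∈ toOrientedGraph.homology ℝ, x ≠ 0 → 0 < ∑ e, w e * x e * x e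

namespace WeightedGraph

/-- The space `H₁(Γ, ℝ)`, to be equipped with `⟨·,·⟩_w` (a separate type, so that the supremum norm
of `Edge → ℝ` is not used). -/
def H1 (Γ : WeightedGraph) : Type := Γ.homology ℝ

instance (Γ : WeightedGraph) : AddCommGroup Γ.H1 := inferInstanceAs (AddCommGroup (Γ.homology ℝ))

instance (Γ : WeightedGraph) : Module ℝ Γ.H1 := inferInstanceAs (Module ℝ (Γ.homology ℝ))

/-- The inclusion of `H₁(Γ, ℝ)` in the space of real 1-chains. -/
def toChain (Γ : WeightedGraph) : Γ.H1 →ₗ[ℝ] (Γ.Edge → ℝ) := (Γ.homology ℝ).subtype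

theorem toChain_injective (Γ : WeightedGraph) : Function.Injective Γ.toChain :=
  Subtype.val_injective

instance (Γ : WeightedGraph) : FiniteDimensional ℝ Γ.H1 :=
  inferInstanceAs (FiniteDimensional ℝ (Γ.homology ℝ))

/-- The scalar product `⟨x, y⟩_w = ∑ w(e) x(e) y(e)` on `H₁(Γ, ℝ)`. -/
abbrev core (Γ : WeightedGraph) : InnerProductSpace.Core ℝ Γ.H1 where
  inner x y := ∑ e, Γ.w e * Γ.toChain x e * Γ.toChain y e
  conj_inner_symm x y := by
    simp only [conj_trivial]
    exact Finset.sum_congr rfl fun e _ => by ring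
  re_inner_nonneg x := by
    simp only [RCLike.re_to_real]
    exact Finset.sum_nonneg fun e _ => by
      rw [mul_assoc]; exact mul_nonneg (Γ.w_nonneg e) (mul_self_nonneg _)
  add_left x y z := by
    rw [← Finset.sum_add_distrib]
    exact Finset.sum_congr rfl fun e _ => by rw [map_add, Pi.add_apply]; ring
  smul_left x y r := by
    simp only [conj_trivial]
    rw [Finset.mul_sum]
    exact Finset.sum_congr rfl fun e _ => by
      rw [map_smul, Pi.smul_apply, smul_eq_mul]; ring
  definite x hx := by
    by_contra h
    have h1 : Γ.toChain x ≠ 0 := fun h0 => h (Γ.toChain_injective (by rw [h0, map_zero]))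
    exact (Γ.form_pos (Γ.toChain x) x.2 h1).ne' hx

instance (Γ : WeightedGraph) : NormedAddCommGroup Γ.H1 :=
  @InnerProductSpace.Core.toNormedAddCommGroup ℝ Γ.H1 _ _ _ Γ.core

instance (Γ : WeightedGraph) : InnerProductSpace ℝ Γ.H1 :=
  InnerProductSpace.ofCore Γ.core.toCore

instance (Γ : WeightedGraph) : MeasurableSpace Γ.H1 := borel _

instance (Γ : WeightedGraph) : BorelSpace Γ.H1 := ⟨rfl⟩

theorem inner_def (Γ : WeightedGraph) (x y : Γ.H1) :
    inner ℝ x y = ∑ e, Γ.w e * Γ.toChain x e * Γ.toChain y e := rfl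

/-- The Jacobian `Λ(Γ, w) = H₁(Γ, ℤ) ⊂ (H₁(Γ, ℝ), ⟨·,·⟩_w)`: the real cycles which come from
integral cycles. -/
def jacobian (Γ : WeightedGraph) : Submodule ℤ Γ.H1 where
  carrier := {x | ∃ z ∈ Γ.homology ℤ, ∀ e, Γ.toChain x e = (z e : ℝ)}
  add_mem' := by
    rintro x y ⟨z, hz, hx⟩ ⟨t, ht, hy⟩
    exact ⟨z + t, add_mem hz ht, fun e => by simp [hx, hy]⟩
  zero_mem' := ⟨0, zero_mem _, fun e => by simp⟩
  smul_mem' := by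
    rintro n x ⟨z, hz, hx⟩
    exact ⟨n • z, Submodule.smul_mem _ n hz, fun e => by simp [hx]⟩

end WeightedGraph

/-- The Hermite invariants of the Jacobians of the weighted graphs of first Betti number `b`. -/
def jacobianHermiteSet (b : ℕ) : Set ℝ :=
  {r | ∃ Γ : WeightedGraph, Γ.betti = b ∧ r = hermiteInvariant Γ.jacobian}

/-- `ρ_b`, the supremum of these Hermite invariants. -/
def rho (b : ℕ) : ℝ := sSup (jacobianHermiteSet b)

/-- The asymptotic inequality `f ≲ g`, i.e. `limsup f(n)/g(n) ≤ 1` (for eventually positive `g`). -/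
def AsympLE (f g : ℕ → ℝ) : Prop :=
  ∀ ε : ℝ, 0 < ε → ∀ᶠ n in atTop, f n ≤ (1 + ε) * g n

end

/-! Upper bound. Every invariant in question is at most G = 2⌊log₂ b⌋ + 4. Call two edges in series
if their coefficients agree up to a common sign in all cycles. A multigraph with at most b
independent cycles has a simple cycle meeting at most G series classes
(`Multigraph.exists_short_cycle`): delete bridges and contract series edges until all degrees are at
least 3; a search tree then doubles at each level until it closes a cycle, and there are at most 2b
vertices. If all simple cycles have length at least s, some class on that cycle has weight at least
s/G. Deleting an edge r of this class lowers the rank by one and divides the Gram determinant by at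
least s/G (`Multigraph.exists_basis_det_gram_ge`). Hence det ≥ (s/G)^b, and with s = ‖Λ‖ the Hermite
invariant is at most G.

Lower bound. A greedy construction (`SimpleGraph.exists_girthGE`) gives a graph with n = ⌊b/2⌋ + 1
vertices, Betti number b, degrees at most 7 and girth at least g = ⌊log₆₄ b⌋. With unit weights ‖Λ‖
≥ g. The determinant is at most that of the reduced Laplacian, hence at most 7^(n-1) by the
arithmetic-geometric mean inequality. So ρ_b ≥ g/√7, and √7 < e leaves room for the rounding of g.
-/

/-! ### Gram determinants and integral homology. -/

theorem latticeDet_span_eq_det_gram {E ι : Type*} [NormedAddCommGroup E] [InnerProductSpace ℝ E]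
    [FiniteDimensional ℝ E] [MeasurableSpace E] [BorelSpace E] [Fintype ι] [DecidableEq ι]
    (b : Module.Basis ι ℝ E) :
    latticeDet (Submodule.span ℤ (Set.range b)) = (Matrix.gram ℝ b).det := by
  have hc : Fintype.card ι = Module.finrank ℝ E := (Module.finrank_eq_card_basis b).symm
  let o : OrthonormalBasis ι ℝ E :=
    (stdOrthonormalBasis ℝ E).reindex ((finCongr hc.symm).trans (Fintype.equivFin ι).symm)
  rw [latticeDet, ZLattice.covolume_eq_measure_fundamentalDomain _ _
    (ZSpan.isAddFundamentalDomain b volume), ZSpan.measureReal_fundamentalDomain b volume o.toBasis,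
    measureReal_congr (ZSpan.fundamentalDomain_ae_parallelepiped o.toBasis volume)]
  have h1 : volume.real (parallelepiped o.toBasis) = 1 := by
    simp [Measure.real, o.volume_parallelepiped]
  rw [h1, mul_one, sq_abs, Matrix.gram_eq_conjTranspose_mul o, Matrix.det_mul,
    Matrix.det_conjTranspose, star_trivial, ← sq]
  rfl

/-- Integral vectors which are independent over `ℤ` have a nonsingular Gram matrix. -/
theorem det_mul_transpose_ne_zero {ι E : Type*} [Fintype ι] [DecidableEq ι] [Fintype E]
    {v : ι → E → ℤ} (hv : LinearIndependent ℤ v) :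
    (Matrix.of v * (Matrix.of v).transpose).det ≠ 0 := by
  intro h
  obtain ⟨y, hy0, hy⟩ := Matrix.exists_mulVec_eq_zero_iff.mpr h
  have h1 : (Matrix.of v).transpose.mulVec y ⬝ᵥ (Matrix.of v).transpose.mulVec y = 0 := by
    rw [Matrix.mulVec_transpose, ← Matrix.dotProduct_mulVec, ← Matrix.mulVec_transpose,
      Matrix.mulVec_mulVec, hy, dotProduct_zero]
  rw [dotProduct_self_eq_zero] at h1
  refine hy0 (funext fun i => Fintype.linearIndependent_iff.mp hv y ?_ i)
  funext e
  simpa [Matrix.mulVec, dotProduct, mul_comm] using congrFun h1 e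

/-- The Gram determinant is a nonzero integer, so it stays nonzero in `ℝ`. -/
theorem linearIndependent_intCast {ι E : Type*} [Fintype ι] [Fintype E]
    {v : ι → E → ℤ} (hv : LinearIndependent ℤ v) :
    LinearIndependent ℝ (fun i e => (v i e : ℝ)) := by
  classical
  have h := det_mul_transpose_ne_zero hv
  rw [Fintype.linearIndependent_iff]
  intro c hc
  have h2 : ((Matrix.of v * (Matrix.of v).transpose).map (Int.castRingHom ℝ)).det ≠ 0 := by
    rw [← RingHom.mapMatrix_apply, ← RingHom.map_det]
    simpa using h
  have h3 := Matrix.eq_zero_of_vecMul_eq_zero h2 (v := c) (by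
    rw [Matrix.map_mul, ← Matrix.vecMul_vecMul]
    have h4 : Matrix.vecMul c ((Matrix.of v).map (Int.castRingHom ℝ)) = 0 := by
      funext e
      simpa [Matrix.vecMul, dotProduct] using congrFun hc e
    rw [h4, Matrix.zero_vecMul])
  exact fun i => congrFun h3 i

namespace OrientedGraph

theorem boundary_apply (Γ : OrientedGraph) (R : Type) [CommRing R] (x : Γ.Edge → R) (v : Γ.V) :
    Γ.boundary R x v =
      ∑ e, x e * ((if Γ.head e = v then 1 else 0) - (if Γ.tail e = v then 1 else 0)) := by
  simp [boundary, LinearMap.sum_apply, Finset.sum_apply, Pi.single_apply, eq_comm]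

theorem boundary_intCast (Γ : OrientedGraph) (x : Γ.Edge → ℤ) (v : Γ.V) :
    Γ.boundary ℝ (fun e => (x e : ℝ)) v = (Γ.boundary ℤ x v : ℝ) := by
  simp [boundary_apply]

theorem intCast_mem_homology (Γ : OrientedGraph) {x : Γ.Edge → ℤ} (hx : x ∈ Γ.homology ℤ) :
    (fun e => (x e : ℝ)) ∈ Γ.homology ℝ := by
  refine LinearMap.mem_ker.mpr (funext fun v => ?_)
  rw [boundary_intCast, LinearMap.mem_ker.mp hx]
  simp

/-- The real cycles are the real combinations of the integral ones. -/
theorem betti_eq_finrank_int (Γ : OrientedGraph) :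
    Γ.betti = Module.finrank ℤ (Γ.homology ℤ) := by
  apply le_antisymm
  -- An integral basis of the boundaries stays independent over `ℝ`, so the real rank of the
  -- boundary operator is at least the integral one; rank-nullity over both rings turns this around
  -- for the kernels.
  · let c := Module.Free.chooseBasis ℤ (LinearMap.range (Γ.boundary ℤ))
    have hc : LinearIndependent ℤ (fun i => (c i : Γ.V → ℤ)) :=
      c.linearIndependent.map' (Submodule.subtype _) (Submodule.ker_subtype _)
    have hr := linearIndependent_intCast hc
    have hmem : ∀ i, (fun v => ((c i : Γ.V → ℤ) v : ℝ)) ∈ LinearMap.range (Γ.boundary ℝ) := by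
      intro i
      obtain ⟨x, hx⟩ := (c i).2
      exact ⟨fun e => x e, funext fun v => by rw [boundary_intCast, hx]⟩
    have hr' : LinearIndependent ℝ (fun i => (⟨_, hmem i⟩ : LinearMap.range (Γ.boundary ℝ))) :=
      LinearIndependent.of_comp (Submodule.subtype _) hr
    have h1 := hr'.fintype_card_le_finrank
    have h2 : _ + Γ.betti = _ := LinearMap.finrank_range_add_finrank_ker (Γ.boundary ℝ)
    have h3 : _ + Module.finrank ℤ (Γ.homology ℤ) = _ :=
      Submodule.finrank_quotient_add_finrank (LinearMap.ker (Γ.boundary ℤ))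
    rw [(Γ.boundary ℤ).quotKerEquivRange.finrank_eq, Module.finrank_eq_card_chooseBasisIndex] at h3
    rw [Module.finrank_fintype_fun_eq_card] at h2 h3
    omega
  · let z := Module.Free.chooseBasis ℤ (Γ.homology ℤ)
    have hz : LinearIndependent ℤ (fun i => (z i : Γ.Edge → ℤ)) :=
      z.linearIndependent.map' (Submodule.subtype _) (Submodule.ker_subtype _)
    have hr : LinearIndependent ℝ
        (fun i => (⟨_, Γ.intCast_mem_homology (z i).2⟩ : Γ.homology ℝ)) :=
      LinearIndependent.of_comp (Submodule.subtype _) (linearIndependent_intCast hz)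
    rw [Module.finrank_eq_card_chooseBasisIndex]
    exact hr.fintype_card_le_finrank

end OrientedGraph

namespace WeightedGraph

/-- An integral cycle, as an element of the Euclidean space of real cycles. -/
noncomputable def ofInt (Γ : WeightedGraph) : Γ.homology ℤ →ₗ[ℤ] Γ.H1 :=
  AddMonoidHom.toIntLinearMap
    { toFun := fun x => (⟨fun e => (x.1 e : ℝ), Γ.intCast_mem_homology x.2⟩ : Γ.homology ℝ)
      map_zero' := Γ.toChain_injective (funext fun _ => Int.cast_zero)
      map_add' := fun _ _ => Γ.toChain_injective (funext fun _ => Int.cast_add _ _) }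

theorem toChain_ofInt (Γ : WeightedGraph) (x : Γ.homology ℤ) (e : Γ.Edge) :
    Γ.toChain (Γ.ofInt x) e = ((x : Γ.Edge → ℤ) e : ℝ) := rfl

theorem range_ofInt (Γ : WeightedGraph) : LinearMap.range Γ.ofInt = Γ.jacobian := by
  ext x
  constructor
  · rintro ⟨z, rfl⟩
    exact ⟨z, z.2, fun e => rfl⟩
  · rintro ⟨z, hz, hx⟩
    exact ⟨⟨z, hz⟩, Γ.toChain_injective (funext fun e => (hx e).symm)⟩

theorem inner_ofInt (Γ : WeightedGraph) (x y : Γ.homology ℤ) :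
    inner ℝ (Γ.ofInt x) (Γ.ofInt y) =
      ∑ e, Γ.w e * ((x : Γ.Edge → ℤ) e : ℝ) * ((y : Γ.Edge → ℤ) e : ℝ) := rfl

theorem exists_basis_eq_ofInt {ι : Type*} [Fintype ι] (Γ : WeightedGraph) (z : Module.Basis ι ℤ (Γ.homology ℤ)) :
    ∃ b : Module.Basis ι ℝ Γ.H1, ∀ i, b i = Γ.ofInt (z i) := by
  have hz : LinearIndependent ℤ (fun i => (z i : Γ.Edge → ℤ)) :=
    z.linearIndependent.map' (Submodule.subtype _) (Submodule.ker_subtype _)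
  have hr : LinearIndependent ℝ (fun i => Γ.ofInt (z i)) :=
    LinearIndependent.of_comp Γ.toChain (linearIndependent_intCast hz)
  have hc : Fintype.card ι = Module.finrank ℝ Γ.H1 := by
    rw [← Module.finrank_eq_card_basis z]
    exact Γ.betti_eq_finrank_int.symm
  refine ⟨Module.Basis.mk hr (hr.span_eq_top_of_card_eq_finrank' hc).ge, fun i => ?_⟩
  rw [Module.Basis.mk_apply]

theorem latticeDet_jacobian {ι : Type*} [Fintype ι] [DecidableEq ι] (Γ : WeightedGraph)
    (z : Module.Basis ι ℤ (Γ.homology ℤ)) :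
    latticeDet Γ.jacobian = (Matrix.of fun i j =>
      ∑ e, Γ.w e * ((z i : Γ.Edge → ℤ) e : ℝ) * ((z j : Γ.Edge → ℤ) e : ℝ)).det := by
  obtain ⟨b, hb⟩ := Γ.exists_basis_eq_ofInt z
  have hs : Γ.jacobian = Submodule.span ℤ (Set.range b) := by
    rw [← range_ofInt, funext hb, LinearMap.range_eq_map, ← z.span_eq, Submodule.map_span,
      ← Set.range_comp]
    rfl
  rw [hs, latticeDet_span_eq_det_gram]
  congr 1
  ext i j
  rw [Matrix.gram_apply, hb, hb, inner_ofInt, Matrix.of_apply]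

theorem latticeDet_jacobian_pos (Γ : WeightedGraph) : 0 < latticeDet Γ.jacobian := by
  classical
  let z := Module.Free.chooseBasis ℤ (Γ.homology ℤ)
  obtain ⟨b, hb⟩ := Γ.exists_basis_eq_ofInt z
  have h := (Matrix.posDef_gram_of_linearIndependent b.linearIndependent).det_pos
  rw [latticeDet_jacobian Γ z]
  refine h.trans_eq (congrArg Matrix.det (Matrix.ext fun i j => ?_))
  rw [Matrix.gram_apply, hb, hb, inner_ofInt, Matrix.of_apply]

end WeightedGraph

/-! ### Short cycles in multigraphs -/

namespace Multigraph

open Finset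

variable {V E : Type*} [DecidableEq V] [Fintype E] [DecidableEq E]

/-- The boundary operator of the multigraph whose edge `e` goes from `t e` to `h e`. -/
def bdry (t h : E → V) : (E → ℤ) →ₗ[ℤ] (V → ℤ) :=
  Fintype.linearCombination ℤ fun e => Pi.single (h e) 1 - Pi.single (t e) 1

/-- The integral cycles of a multigraph which are supported in the set `F` of edges. -/
def cycleLattice (t h : E → V) (F : Finset E) : Submodule ℤ (E → ℤ) where
  carrier := {x | (∀ e ∉ F, x e = 0) ∧ bdry t h x = 0}
  add_mem' := by
    rintro x y ⟨hx, hx'⟩ ⟨hy, hy'⟩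
    exact ⟨fun e he => by simp [hx e he, hy e he], by rw [map_add, hx', hy', add_zero]⟩
  zero_mem' := ⟨fun _ _ => rfl, map_zero _⟩
  smul_mem' := by
    rintro c x ⟨hx, hx'⟩
    exact ⟨fun e he => by simp [hx e he], by rw [map_smul, hx', smul_zero]⟩

/-- The support of a chain. -/
def csupp (x : E → ℤ) : Finset E := univ.filter fun e => x e ≠ 0

/-- The edges of `F` which are incident to `v`. -/
def star (t h : E → V) (F : Finset E) (v : V) : Finset E := F.filter fun e => t e = v ∨ h e = v

/-- The vertices which are incident to some edge of `F`. -/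
def verts (t h : E → V) (F : Finset E) : Finset V := F.image t ∪ F.image h

omit [DecidableEq V] [DecidableEq E] in
theorem mem_csupp {x : E → ℤ} {e : E} : e ∈ csupp x ↔ x e ≠ 0 := by simp [csupp]

omit [Fintype E] [DecidableEq E] in
theorem mem_star {t h : E → V} {F : Finset E} {v : V} {e : E} :
    e ∈ star t h F v ↔ e ∈ F ∧ (t e = v ∨ h e = v) := by simp [star]

omit [Fintype E] [DecidableEq E] in
theorem mem_verts {t h : E → V} {F : Finset E} {v : V} :
    v ∈ verts t h F ↔ ∃ e ∈ F, t e = v ∨ h e = v := by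
  simp only [verts, mem_union, mem_image]
  constructor
  · rintro (⟨e, he, rfl⟩ | ⟨e, he, rfl⟩) <;> exact ⟨e, he, by simp⟩
  · rintro ⟨e, he, h | h⟩
    exacts [Or.inl ⟨e, he, h⟩, Or.inr ⟨e, he, h⟩]

omit [DecidableEq E] in
theorem bdry_apply (t h : E → V) (x : E → ℤ) (v : V) :
    bdry t h x v = ∑ e, x e * ((if h e = v then 1 else 0) - (if t e = v then 1 else 0)) := by
  simp [bdry, Fintype.linearCombination_apply, Finset.sum_apply, Pi.single_apply, eq_comm]

theorem bdry_single (t h : E → V) (e : E) (c : ℤ) :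
    bdry t h (Pi.single e c) = c • (Pi.single (h e) 1 - Pi.single (t e) 1) := by
  rw [bdry, Fintype.linearCombination_apply_single]

omit [DecidableEq V] in
theorem csupp_add_subset (x y : E → ℤ) : csupp (x + y) ⊆ csupp x ∪ csupp y := by
  intro e he
  rw [mem_union, mem_csupp, mem_csupp]
  rw [mem_csupp, Pi.add_apply] at he
  by_contra hc
  push Not at hc
  exact he (by rw [hc.1, hc.2, add_zero])

omit [DecidableEq V] in
theorem csupp_sub_subset (x y : E → ℤ) : csupp (x - y) ⊆ csupp x ∪ csupp y := by
  intro e he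
  rw [mem_union, mem_csupp, mem_csupp]
  rw [mem_csupp, Pi.sub_apply] at he
  by_contra hc
  push Not at hc
  exact he (by rw [hc.1, hc.2, sub_zero])

omit [DecidableEq V] in
theorem csupp_single_subset (e : E) (c : ℤ) : csupp (Pi.single e c) ⊆ {e} := by
  intro f hf
  rw [mem_csupp] at hf
  rw [mem_singleton]
  by_contra hc
  exact hf (Pi.single_eq_of_ne hc _)

omit [Fintype E] [DecidableEq E] in
/-- Double counting of incidences. -/
theorem sum_card_star (t h : E → V) (F : Finset E) (A : Finset V) :
    ∑ v ∈ A, #(star t h F v) = ∑ e ∈ F, #(A.filter fun v => t e = v ∨ h e = v) :=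
  sum_card_bipartiteAbove_eq_sum_card_bipartiteBelow fun v e => t e = v ∨ h e = v

omit [Fintype E] [DecidableEq E] in
theorem card_filter_ends_le_two (t h : E → V) (A : Finset V) (e : E) :
    #(A.filter fun v => t e = v ∨ h e = v) ≤ 2 := by
  refine (card_le_card (t := {t e, h e}) fun v hv => ?_).trans card_le_two
  rw [mem_filter] at hv
  rcases hv.2 with h | h <;> simp [h]

/-- A tree `(A, T)` with root `r` in a multigraph; `p v` is the path from `r` to `v`. -/
structure SearchTree (t h : E → V) (F : Finset E) (r : V) (s : ℕ) where
  A : Finset V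
  T : Finset E
  p : V → E → ℤ
  A_sub : A ⊆ verts t h F
  T_sub : T ⊆ F
  ends_mem : ∀ e ∈ T, t e ∈ A ∧ h e ∈ A
  card_T : #T + 1 = #A
  le_card : 2 ^ s ≤ #A
  bdry_p : ∀ v ∈ A, bdry t h (p v) = Pi.single v 1 - Pi.single r 1
  p_eq_zero : ∀ v ∈ A, ∀ e ∉ T, p v e = 0
  card_csupp : ∀ v ∈ A, #(csupp (p v)) ≤ s
  abs_sub_le : ∀ v ∈ A, ∀ w ∈ A, ∀ e, |p v e - p w e| ≤ 1

/-- All edges leaving `A` are adjoined at once. An edge outside `T` with both ends in `A`, or two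
leaving edges with the same outer end, would close a cycle with at most 2s + 2 ≤ G edges. So each
leaving edge brings a new vertex, and the degree condition makes their number at least #A. The field
`abs_sub_le` is what keeps the closing cycles within coefficients -1, 0, 1. -/
theorem SearchTree.grow {t h : E → V} {F : Finset E} {r : V} {s G : ℕ} (S : SearchTree t h F r s)
    (hdeg : ∀ v ∈ verts t h F, 3 ≤ #(star t h F v))
    (hno : ∀ x ∈ cycleLattice t h F, (∀ e, |x e| ≤ 1) → x ≠ 0 → G < #(csupp x))
    (hs : 2 * (s + 1) ≤ G) : Nonempty (SearchTree t h F r (s + 1)) := by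
  classical
  obtain ⟨A, T, p, A_sub, T_sub, ends_mem, card_T, le_card, bdry_p, p_eq_zero, card_csupp,
    abs_sub_le⟩ := S
  have hboth : ∀ e ∈ F, e ∉ T → t e ∈ A → h e ∈ A → False := by
    intro e he heT ht hh
    have hx := hno (Pi.single e 1 + (p (t e) - p (h e))) ⟨fun f hf => ?_, ?_⟩ ?_ ?_
    · have h1 := card_le_card (csupp_add_subset (Pi.single e 1) (p (t e) - p (h e)))
      have h2 := card_le_card (csupp_sub_subset (p (t e)) (p (h e)))
      have h3 := card_le_card (csupp_single_subset e 1)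
      have h4 := card_union_le (csupp (Pi.single e 1)) (csupp (p (t e) - p (h e)))
      have h5 := card_union_le (csupp (p (t e))) (csupp (p (h e)))
      have h6 := card_csupp _ ht
      have h7 := card_csupp _ hh
      rw [card_singleton] at h3
      omega
    · have hfe : f ≠ e := fun h => hf (h ▸ he)
      have hfT : f ∉ T := fun h => hf (T_sub h)
      simp [hfe, p_eq_zero _ ht f hfT, p_eq_zero _ hh f hfT]
    · rw [map_add, map_sub, bdry_single, bdry_p _ ht, bdry_p _ hh]
      simp
    · intro f
      by_cases hfe : f = e
      · subst hfe
        simp [p_eq_zero _ ht f heT, p_eq_zero _ hh f heT]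
      · simpa [hfe] using abs_sub_le _ ht _ hh f
    · intro h0
      have := congrFun h0 e
      simp [p_eq_zero _ ht e heT, p_eq_zero _ hh e heT] at this
  let O : Finset E := (F \ T).filter fun e => t e ∈ A ∨ h e ∈ A
  let inn : E → V := fun e => if t e ∈ A then t e else h e
  let out : E → V := fun e => if t e ∈ A then h e else t e
  let sg : E → ℤ := fun e => if t e ∈ A then 1 else -1
  let q : E → E → ℤ := fun e => p (inn e) + Pi.single e (sg e)
  have hO : ∀ e ∈ O, e ∈ F ∧ e ∉ T ∧ (t e ∈ A ∨ h e ∈ A) := by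
    intro e he
    simpa [O, and_assoc] using he
  have hinn : ∀ e ∈ O, inn e ∈ A := by
    intro e he
    by_cases ht : t e ∈ A
    · simp [inn, ht]
    · simpa [inn, ht] using (hO e he).2.2
  have hout : ∀ e ∈ O, out e ∉ A := by
    intro e he
    by_cases ht : t e ∈ A
    · simpa [out, ht] using hboth e (hO e he).1 (hO e he).2.1 ht
    · simp [out, ht]
  have hsg : ∀ e, |sg e| = 1 := by
    intro e
    by_cases ht : t e ∈ A <;> simp [sg, ht]
  have hbq : ∀ e ∈ O, bdry t h (q e) = Pi.single (out e) 1 - Pi.single r 1 := by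
    intro e he
    simp only [q]
    rw [map_add, bdry_p _ (hinn e he), bdry_single]
    by_cases ht : t e ∈ A <;> simp [inn, out, sg, ht]
  have hqT : ∀ e ∈ O, ∀ f, f ∉ T → f ≠ e → q e f = 0 := by
    intro e he f hf hfe
    simp [q, hfe, p_eq_zero _ (hinn e he) f hf]
  have hqe : ∀ e ∈ O, |q e e| = 1 := by
    intro e he
    simp [q, p_eq_zero _ (hinn e he) e (hO e he).2.1, hsg]
  have hq : ∀ e ∈ O, ∀ f, f ≠ e → q e f = p (inn e) f := by
    intro e he f hfe
    simp [q, hfe]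
  have hqs : ∀ e ∈ O, #(csupp (q e)) ≤ s + 1 := by
    intro e he
    have h1 := card_le_card (csupp_add_subset (p (inn e)) (Pi.single e (sg e)))
    have h2 := card_union_le (csupp (p (inn e))) (csupp (Pi.single e (sg e)))
    have h3 := card_le_card (csupp_single_subset e (sg e))
    have h4 := card_csupp _ (hinn e he)
    rw [card_singleton] at h3
    simp only [q]
    omega
  have hqp : ∀ e ∈ O, ∀ w ∈ A, ∀ f, |q e f - p w f| ≤ 1 := by
    intro e he w hw f
    by_cases hfe : f = e
    · subst hfe
      rw [p_eq_zero w hw f (hO f he).2.1, sub_zero, hqe f he]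
    · rw [hq e he f hfe]
      exact abs_sub_le _ (hinn e he) w hw f
  have hqq : ∀ e ∈ O, ∀ e' ∈ O, e ≠ e' → ∀ f, |q e f - q e' f| ≤ 1 := by
    intro e he e' he' hne f
    by_cases hfe : f = e
    · subst hfe
      rw [hqT e' he' f (hO f he).2.1 hne, sub_zero, hqe f he]
    · rw [hq e he f hfe, abs_sub_comm]
      exact hqp e' he' _ (hinn e he) f
  have hinj : Set.InjOn out O := by
    intro e he e' he' hee
    by_contra hne
    have hx := hno (q e - q e') ⟨fun f hf => ?_, ?_⟩ (hqq e he e' he' hne) ?_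
    · have h1 := card_le_card (csupp_sub_subset (q e) (q e'))
      have h2 := card_union_le (csupp (q e)) (csupp (q e'))
      have h3 := hqs e he
      have h4 := hqs e' he'
      omega
    · have hfT : f ∉ T := fun h => hf (T_sub h)
      rw [Pi.sub_apply, hqT e he f hfT fun h => hf (h ▸ (hO e he).1),
        hqT e' he' f hfT fun h => hf (h ▸ (hO e' he').1), sub_zero]
    · rw [map_sub, hbq e he, hbq e' he', hee, sub_self]
    · intro h0
      have h1 := congrFun h0 e
      rw [Pi.sub_apply, hqT e' he' e (hO e he).2.1 hne, sub_zero] at h1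
      have h2 := hqe e he
      rw [h1] at h2
      simp at h2
  -- Edges of `T` count at most twice, leaving edges once, and no other edge of `F` meets `A`. With
  -- #T = #A - 1 this gives #O ≥ #A + 2, hence the doubling.
  have hcount : 3 * #A ≤ 2 * #T + #O := by
    calc 3 * #A = ∑ v ∈ A, 3 := by rw [sum_const, smul_eq_mul, mul_comm]
      _ ≤ ∑ v ∈ A, #(star t h F v) := sum_le_sum fun v hv => hdeg v (A_sub hv)
      _ = ∑ e ∈ F, #(A.filter fun v => t e = v ∨ h e = v) := sum_card_star t h F A
      _ ≤ ∑ e ∈ F, ((if e ∈ T then 2 else 0) + (if e ∈ O then 1 else 0)) := by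
          refine sum_le_sum fun e he => ?_
          by_cases heT : e ∈ T
          · rw [if_pos heT]
            exact (card_filter_ends_le_two t h A e).trans (Nat.le_add_right _ _)
          by_cases heO : e ∈ O
          · rw [if_neg heT, if_pos heO, zero_add, card_le_one]
            intro a ha b hb
            rw [mem_filter] at ha hb
            have := hboth e he heT
            rcases ha with ⟨ha, rfl | rfl⟩ <;> rcases hb with ⟨hb, hb' | hb'⟩
            · exact hb'
            · exact (this ha (hb' ▸ hb)).elim
            · exact (this (hb' ▸ hb) ha).elim
            · exact hb'
          · rw [if_neg heT, if_neg heO, Nat.add_zero, Nat.le_zero, card_eq_zero,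
              filter_eq_empty_iff]
            intro v hv hv'
            refine heO (mem_filter.mpr ⟨mem_sdiff.mpr ⟨he, heT⟩, ?_⟩)
            rcases hv' with rfl | rfl
            exacts [Or.inl hv, Or.inr hv]
      _ = 2 * #T + #O := by
          have hOF : O ⊆ F := fun e he => (hO e he).1
          rw [sum_add_distrib, sum_ite_mem, sum_ite_mem, inter_eq_right.mpr T_sub,
            inter_eq_right.mpr hOF]
          simp [mul_comm]
  have hcardA : #(A ∪ O.image out) = #A + #O := by
    rw [card_union_of_disjoint, card_image_of_injOn hinj]
    rw [disjoint_right]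
    intro v hv
    obtain ⟨e, he, rfl⟩ := mem_image.mp hv
    exact hout e he
  have hcardT : #(T ∪ O) = #T + #O :=
    card_union_of_disjoint (disjoint_right.mpr fun e he => (hO e he).2.1)
  have hex : ∀ v, ∃ c : E → ℤ, v ∈ A ∪ O.image out →
      (v ∈ A ∧ c = p v) ∨ ∃ e ∈ O, out e = v ∧ c = q e := by
    intro v
    by_cases hv : v ∈ A ∪ O.image out
    · rcases mem_union.mp hv with hv | hv
      · exact ⟨p v, fun _ => Or.inl ⟨hv, rfl⟩⟩
      · obtain ⟨e, he, hev⟩ := mem_image.mp hv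
        exact ⟨q e, fun _ => Or.inr ⟨e, he, hev, rfl⟩⟩
    · exact ⟨0, fun h => (hv h).elim⟩
  choose p' hp' using hex
  refine ⟨⟨A ∪ O.image out, T ∪ O, p', ?_, ?_, ?_, ?_, ?_, ?_, ?_, ?_, ?_⟩⟩
  · refine union_subset A_sub fun v hv => ?_
    obtain ⟨e, he, rfl⟩ := mem_image.mp hv
    refine mem_verts.mpr ⟨e, (hO e he).1, ?_⟩
    by_cases ht : t e ∈ A <;> simp [out, ht]
  · exact union_subset T_sub fun e he => (hO e he).1
  · intro e he
    rcases mem_union.mp he with he | he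
    · exact ⟨mem_union_left _ (ends_mem e he).1, mem_union_left _ (ends_mem e he).2⟩
    · have h1 : inn e ∈ A ∪ O.image out := mem_union_left _ (hinn e he)
      have h2 : out e ∈ A ∪ O.image out := mem_union_right _ (mem_image_of_mem _ he)
      by_cases ht : t e ∈ A
      · simp only [inn, out, if_pos ht] at h1 h2
        exact ⟨h1, h2⟩
      · simp only [inn, out, if_neg ht] at h1 h2
        exact ⟨h2, h1⟩
  · omega
  · rw [pow_succ]
    omega
  · intro v hv
    rcases hp' v hv with ⟨hv, hc⟩ | ⟨e, he, rfl, hc⟩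
    · rw [hc, bdry_p v hv]
    · rw [hc, hbq e he]
  · intro v hv f hf
    rw [mem_union, not_or] at hf
    rcases hp' v hv with ⟨hv, hc⟩ | ⟨e, he, rfl, hc⟩
    · rw [hc, p_eq_zero v hv f hf.1]
    · rw [hc, hqT e he f hf.1 fun h => hf.2 (h ▸ he)]
  · intro v hv
    rcases hp' v hv with ⟨hv, hc⟩ | ⟨e, he, rfl, hc⟩
    · rw [hc]
      exact (card_csupp v hv).trans (Nat.le_succ s)
    · rw [hc]
      exact hqs e he
  · intro v hv w hw f
    rcases hp' v hv with ⟨hv, hc⟩ | ⟨e, he, -, hc⟩ <;>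
      rcases hp' w hw with ⟨hw, hc'⟩ | ⟨e', he', -, hc'⟩ <;> rw [hc, hc']
    · exact abs_sub_le v hv w hw f
    · rw [abs_sub_comm]
      exact hqp e' he' v hv f
    · exact hqp e he w hw f
    · by_cases hee : e = e'
      · rw [hee, sub_self, abs_zero]
        exact zero_le_one
      · exact hqq e he e' he' hee f

/-- A multigraph without short cycles, all of whose vertices have degree at least 3, has many
vertices. -/
theorem two_pow_le_card_verts {t h : E → V} {F : Finset E} {G : ℕ} (hF : F.Nonempty)
    (hdeg : ∀ v ∈ verts t h F, 3 ≤ #(star t h F v))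
    (hno : ∀ x ∈ cycleLattice t h F, (∀ e, |x e| ≤ 1) → x ≠ 0 → G < #(csupp x))
    {s : ℕ} (hs : 2 * s ≤ G) : 2 ^ s ≤ #(verts t h F) := by
  obtain ⟨e, he⟩ := hF
  have key : ∀ s, 2 * s ≤ G → Nonempty (SearchTree t h F (t e) s) := by
    intro s
    induction s with
    | zero =>
      intro _
      refine ⟨⟨{t e}, ∅, 0, ?_, ?_, ?_, ?_, ?_, ?_, ?_, ?_, ?_⟩⟩
      · exact singleton_subset_iff.mpr (mem_verts.mpr ⟨e, he, Or.inl rfl⟩)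
      all_goals simp [csupp]
    | succ s ih =>
      intro hs
      obtain ⟨S⟩ := ih (by omega)
      exact S.grow hdeg hno hs
  obtain ⟨S⟩ := key s hs
  exact S.le_card.trans (card_le_card S.A_sub)

end Multigraph

/-! ### Reduction to minimal degree 3: deletion and contraction. -/

namespace Multigraph

open Finset

variable {V E : Type*} [DecidableEq V] [Fintype E] [DecidableEq E]

theorem bdry_apply_eq_zero_of_notMem_verts {t h : E → V} {F : Finset E} {x : E → ℤ}
    (hx : ∀ e ∉ F, x e = 0) {v : V} (hv : v ∉ verts t h F) : bdry t h x v = 0 := by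
  rw [bdry_apply]
  refine sum_eq_zero fun e _ => ?_
  by_cases he : e ∈ F
  · have h1 : ¬ (t e = v ∨ h e = v) := fun hc => hv (mem_verts.mpr ⟨e, he, hc⟩)
    rw [not_or] at h1
    rw [if_neg h1.1, if_neg h1.2, sub_zero, mul_zero]
  · rw [hx e he, zero_mul]

/-- Rank-nullity for the boundary operator from chains on `F` to functions on its vertices. -/
theorem card_le_finrank_add_card_verts (t h : E → V) (F : Finset E) :
    #F ≤ Module.finrank ℤ (cycleLattice t h F) + #(verts t h F) := by
  let ext : (F → ℤ) →ₗ[ℤ] (E → ℤ) := Function.ExtendByZero.linearMap ℤ (Subtype.val : F → E)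
  have hext0 : ∀ x : F → ℤ, ∀ e ∉ F, ext x e = 0 := fun x e he =>
    Function.extend_apply' _ _ _ fun ⟨a, ha⟩ => he (ha ▸ a.2)
  have hext : ∀ (x : F → ℤ) (e : F), ext x e = x e := fun x e =>
    Subtype.val_injective.extend_apply x 0 e
  let φ : (F → ℤ) →ₗ[ℤ] (verts t h F → ℤ) :=
    LinearMap.funLeft ℤ ℤ (Subtype.val : verts t h F → V) ∘ₗ bdry t h ∘ₗ ext
  have hφ : ∀ x ∈ LinearMap.ker φ, ext x ∈ cycleLattice t h F := by
    intro x hx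
    refine ⟨hext0 x, funext fun v => ?_⟩
    by_cases hv : v ∈ verts t h F
    · exact congrFun (LinearMap.mem_ker.mp hx) ⟨v, hv⟩
    · exact bdry_apply_eq_zero_of_notMem_verts (hext0 x) hv
  let ψ : LinearMap.ker φ →ₗ[ℤ] cycleLattice t h F :=
    (ext ∘ₗ (LinearMap.ker φ).subtype).codRestrict _ fun x => hφ x x.2
  have hψ : Function.Injective ψ := by
    intro x y hxy
    have h1 : ext x = ext y := congrArg Subtype.val hxy
    refine Subtype.ext (funext fun e => ?_)
    rw [← hext x e, ← hext y e, h1]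
  have h1 := LinearMap.finrank_le_finrank_of_injective hψ
  have h2 := Submodule.finrank_quotient_add_finrank (LinearMap.ker φ)
  rw [φ.quotKerEquivRange.finrank_eq, Module.finrank_fintype_fun_eq_card, Fintype.card_coe] at h2
  have h3 := Submodule.finrank_le (LinearMap.range φ)
  rw [Module.finrank_fintype_fun_eq_card, Fintype.card_coe] at h3
  omega

/-- In a multigraph without bridges, loops and pairs of edges in series, all degrees are at
least 3. -/
theorem three_le_card_star {t h : E → V} {F : Finset E} (hloop : ∀ e ∈ F, t e ≠ h e)
    (hlive : ∀ e ∈ F, ∃ y ∈ cycleLattice t h F, y e ≠ 0)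
    (hser : ∀ e ∈ F, ∀ f ∈ F, e ≠ f → ∀ ε : ℤ, ε * ε = 1 →
      ∃ y ∈ cycleLattice t h F, y f ≠ ε * y e) :
    ∀ v ∈ verts t h F, 3 ≤ #(star t h F v) := by
  intro v hv
  obtain ⟨e, he, hev⟩ := mem_verts.mp hv
  have heS : e ∈ star t h F v := mem_star.mpr ⟨he, hev⟩
  let s : E → ℤ := fun e => (if h e = v then 1 else 0) - (if t e = v then 1 else 0)
  have hs : ∀ e ∈ star t h F v, s e * s e = 1 := by
    intro e he
    rw [mem_star] at he
    have := hloop e he.1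
    rcases he.2 with h1 | h1
    · have h2 : h e ≠ v := fun h2 => this (h1.trans h2.symm)
      simp [s, h1, h2]
    · have h2 : t e ≠ v := fun h2 => this (h2.trans h1.symm)
      simp [s, h1, h2]
  have hsum : ∀ y ∈ cycleLattice t h F, ∑ f ∈ star t h F v, y f * s f = 0 := by
    intro y hy
    have h1 := congrFun hy.2 v
    rw [bdry_apply] at h1
    refine Eq.trans (sum_subset (subset_univ _) fun f _ hf => ?_) h1
    by_cases hfF : f ∈ F
    · have h2 : ¬ (t f = v ∨ h f = v) := fun hc => hf (mem_star.mpr ⟨hfF, hc⟩)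
      rw [not_or] at h2
      simp [s, h2.1, h2.2]
    · rw [hy.1 f hfF, zero_mul]
  -- The equation ∂y = 0 at `v` is a signed sum over the star. One edge there would have coefficient
  -- 0 in every cycle; two edges would be in series.
  by_contra hlt
  obtain hc | hc : #(star t h F v) = 1 ∨ #(star t h F v) = 2 := by
    have := card_pos.mpr ⟨e, heS⟩
    omega
  · obtain ⟨a, ha⟩ := card_eq_one.mp hc
    rw [ha, mem_singleton] at heS
    subst heS
    obtain ⟨y, hy, hy0⟩ := hlive e he
    have h1 := hsum y hy
    have h2 := hs e (by rw [ha]; exact mem_singleton_self e)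
    rw [ha, sum_singleton] at h1
    exact hy0 (by linear_combination s e * h1 - y e * h2)
  · obtain ⟨a, b, hab, hS⟩ := card_eq_two.mp hc
    have haS : a ∈ star t h F v := by simp [hS]
    have hbS : b ∈ star t h F v := by simp [hS]
    have ha2 := hs a haS
    have hb2 := hs b hbS
    obtain ⟨y, hy, hy0⟩ := hser a (mem_star.mp haS).1 b (mem_star.mp hbS).1 hab
      (-(s a * s b)) (by linear_combination s b * s b * ha2 + hb2)
    have h1 := hsum y hy
    rw [hS, sum_pair hab] at h1
    exact hy0 (by linear_combination s b * h1 - y b * hb2)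

/-- The end points of the edges after the end points of `f` have been identified. -/
def identify (t h : E → V) (f : E) (v : V) : V := if v = h f then t f else v

omit [DecidableEq E] in
theorem bdry_identify (t h : E → V) {f : E} (hf : t f ≠ h f) (x : E → ℤ) (v : V) :
    bdry (identify t h f ∘ t) (identify t h f ∘ h) x v =
      if v = h f then 0 else if v = t f then bdry t h x (t f) + bdry t h x (h f)
      else bdry t h x v := by
  have key : ∀ u : V, (if identify t h f u = v then (1 : ℤ) else 0) =
      if v = h f then 0 else if v = t f then (if u = t f then 1 else 0) + (if u = h f then 1 else 0)
      else if u = v then 1 else 0 := by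
    intro u
    unfold identify
    grind
  simp only [bdry_apply, Function.comp_apply, key]
  split_ifs with h1 h2
  · simp
  · rw [← sum_add_distrib]
    exact sum_congr rfl fun e _ => by ring
  · rfl

theorem sub_single_mem_cycleLattice_identify {t h : E → V} {F : Finset E} {f : E}
    (hf : t f ≠ h f) {y : E → ℤ} (hy : y ∈ cycleLattice t h F) :
    y - Pi.single f (y f) ∈
      cycleLattice (identify t h f ∘ t) (identify t h f ∘ h) (F.erase f) := by
  constructor
  · intro e he
    by_cases hef : e = f
    · subst hef
      simp
    · have : e ∉ F := fun h => he (mem_erase.mpr ⟨hef, h⟩)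
      simp [hef, hy.1 e this]
  · rw [map_sub, bdry_single]
    have : bdry (identify t h f ∘ t) (identify t h f ∘ h) y = 0 := by
      funext v
      rw [bdry_identify t h hf, hy.2]
      simp
    rw [this]
    simp [identify]

/-- A cycle of the contracted multigraph lifts: the boundary at `h f` dictates the coefficient of
`f`, and the boundary at `t f` then vanishes too, since contraction only sees the sum of the two. -/
theorem exists_add_single_mem_cycleLattice {t h : E → V} {F : Finset E} {f : E} (hfF : f ∈ F)
    (hf : t f ≠ h f) {z : E → ℤ}
    (hz : z ∈ cycleLattice (identify t h f ∘ t) (identify t h f ∘ h) (F.erase f)) :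
    ∃ c : ℤ, z + Pi.single f c ∈ cycleLattice t h F := by
  refine ⟨- bdry t h z (h f), fun e he => ?_, ?_⟩
  · have h1 : e ≠ f := fun h => he (h ▸ hfF)
    have h2 : e ∉ F.erase f := fun h => he (mem_of_mem_erase h)
    simp [h1, hz.1 e h2]
  · rw [map_add, bdry_single]
    funext v
    have h1 := congrFun hz.2 v
    have h2 := congrFun hz.2 (t f)
    rw [bdry_identify t h hf, if_neg hf, if_pos rfl] at h2
    rw [bdry_identify t h hf] at h1
    simp only [Pi.zero_apply] at h1 h2
    by_cases hv1 : v = h f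
    · subst hv1
      simp [hf]
    · by_cases hv2 : v = t f
      · subst hv2
        simp [hf]
        linarith
      · rw [if_neg hv1, if_neg hv2] at h1
        simp [hv1, hv2, h1]

/-- A multigraph with `k` independent cycles contains a simple cycle which meets at most
`2 log₂ k + 4` series classes of edges. -/
theorem exists_short_cycle (k : ℕ) : ∀ (n : ℕ) (t h : E → V) (F : Finset E), #F = n →
    cycleLattice t h F ≠ ⊥ → Module.finrank ℤ (cycleLattice t h F) ≤ k →
    ∃ x ∈ cycleLattice t h F, x ≠ 0 ∧ (∀ e, |x e| ≤ 1) ∧ ∃ R ⊆ csupp x, #R ≤ 2 * Nat.log 2 k + 4 ∧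
      ∀ e ∈ csupp x, ∃ r ∈ R, ∃ ε : ℤ, ε * ε = 1 ∧
        ∀ y ∈ cycleLattice t h F, y e = ε * y r := by
  intro n
  induction n with
  | zero =>
    intro t h F hF hne
    refine (hne (eq_bot_iff.mpr fun x hx => ?_)).elim
    rw [card_eq_zero] at hF
    subst hF
    exact funext fun e => hx.1 e (notMem_empty e)
  | succ n ih =>
    intro t h F hF hne hk
    by_cases hlive : ∀ e ∈ F, ∃ y ∈ cycleLattice t h F, y e ≠ 0
    swap
    -- An edge with coefficient 0 in all cycles can be deleted without changing the cycle lattice.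
    · push Not at hlive
      obtain ⟨f, hf, hf0⟩ := hlive
      have heq : cycleLattice t h (F.erase f) = cycleLattice t h F := by
        ext y
        refine ⟨fun hy => ⟨fun e he => hy.1 e fun h => he (mem_of_mem_erase h), hy.2⟩,
          fun hy => ⟨fun e he => ?_, hy.2⟩⟩
        by_cases hef : e = f
        · exact hef ▸ hf0 y hy
        · exact hy.1 e fun h => he (mem_erase.mpr ⟨hef, h⟩)
      have := ih t h (F.erase f) (by rw [card_erase_of_mem hf, hF, Nat.add_sub_cancel])
      rw [heq] at this
      exact this hne hk
    by_cases hser : ∀ e ∈ F, ∀ f ∈ F, e ≠ f → ∀ ε : ℤ, ε * ε = 1 →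
      ∃ y ∈ cycleLattice t h F, y f ≠ ε * y e
    swap
    -- The edge `f` is in series with `e`, so it can be contracted: forgetting its coefficient maps
    -- the cycles onto those of the contraction. A lifted cycle has coefficient ±`x e` at `f`, and
    -- the representatives `R` still serve.
    · push Not at hser
      obtain ⟨e, he, f, hf, hef, ε, hε, hall⟩ := hser
      -- A loop at `f` would be a cycle avoiding `e`, contradicting the series relation.
      have hloop : t f ≠ h f := by
        intro hl
        have h1 : Pi.single f 1 ∈ cycleLattice t h F := by
          refine ⟨fun a ha => Pi.single_eq_of_ne (fun h => ha (by rw [h]; exact hf)) _, ?_⟩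
          rw [bdry_single, hl, sub_self, smul_zero]
        have h2 := hall _ h1
        rw [Pi.single_eq_same, Pi.single_eq_of_ne hef, mul_zero] at h2
        exact one_ne_zero h2
      set t' := identify t h f ∘ t
      set h' := identify t h f ∘ h
      let res : cycleLattice t h F →ₗ[ℤ] cycleLattice t' h' (F.erase f) :=
        LinearMap.codRestrict _
          ((LinearMap.id - (LinearMap.single ℤ (fun _ : E => ℤ) f) ∘ₗ (LinearMap.proj f)) ∘ₗ
            (cycleLattice t h F).subtype)
          fun y => sub_single_mem_cycleLattice_identify hloop y.2
      have hres : ∀ y : cycleLattice t h F, ∀ a, a ≠ f → (res y : E → ℤ) a = (y : E → ℤ) a := by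
        intro y a ha
        change (y : E → ℤ) a - (Pi.single f ((y : E → ℤ) f) : E → ℤ) a = _
        rw [Pi.single_eq_of_ne ha, sub_zero]
      have hresf : ∀ z ∈ cycleLattice t' h' (F.erase f), z f = 0 := fun z hz =>
        hz.1 f (notMem_erase f F)
      have hsurj : Function.Surjective res := by
        intro z
        obtain ⟨c, hc⟩ := exists_add_single_mem_cycleLattice hf hloop z.2
        refine ⟨⟨_, hc⟩, Subtype.ext (funext fun a => ?_)⟩
        by_cases ha : a = f
        · subst ha
          rw [hresf _ (res _).2, hresf _ z.2]
        · rw [hres _ a ha]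
          simp [ha]
      have hk' : Module.finrank ℤ (cycleLattice t' h' (F.erase f)) ≤ k :=
        (LinearMap.finrank_le_finrank_of_surjective hsurj).trans hk
      have hne' : cycleLattice t' h' (F.erase f) ≠ ⊥ := by
        obtain ⟨y, hy, hye⟩ := hlive e he
        intro hbot
        have h1 : (res ⟨y, hy⟩ : E → ℤ) = 0 := hbot.le (res ⟨y, hy⟩).2
        have h2 := hres ⟨y, hy⟩ e hef
        rw [h1] at h2
        exact hye h2.symm
      obtain ⟨z, hz, hz0, hz1, R, hR, hRc, hRz⟩ := ih t' h' (F.erase f)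
        (by rw [card_erase_of_mem hf, hF, Nat.add_sub_cancel]) hne' hk'
      obtain ⟨x, hxz⟩ := hsurj ⟨z, hz⟩
      have hxa : ∀ a, a ≠ f → (x : E → ℤ) a = z a := by
        intro a ha
        rw [← hres x a ha, hxz]
      have hεabs : |ε| = 1 := by
        rcases mul_self_eq_one_iff.mp hε with h | h <;> simp [h]
      have hrf : ∀ r ∈ R, r ≠ f := by
        intro r hr hrf
        exact mem_csupp.mp (hR hr) (by rw [hrf, hresf z hz])
      have hlift : ∀ a, a ≠ f → a ∈ csupp (x : E → ℤ) → ∃ r ∈ R, ∃ ε : ℤ, ε * ε = 1 ∧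
          ∀ y ∈ cycleLattice t h F, y a = ε * y r := by
        intro a ha hax
        rw [mem_csupp, hxa a ha] at hax
        obtain ⟨r, hr, η, hη, hηy⟩ := hRz a (mem_csupp.mpr hax)
        refine ⟨r, hr, η, hη, fun y hy => ?_⟩
        have := hηy _ (res ⟨y, hy⟩).2
        rwa [hres _ a ha, hres _ r (hrf r hr)] at this
      refine ⟨x, x.2, fun h0 => hz0 (funext fun a => ?_), fun a => ?_, R, fun r hr => ?_, hRc,
        fun a hax => ?_⟩
      · by_cases ha : a = f
        · rw [ha, hresf z hz]
          rfl
        · rw [← hxa a ha, h0]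
      · by_cases ha : a = f
        · rw [ha, hall x x.2, abs_mul, hεabs, one_mul, hxa e hef]
          exact hz1 e
        · rw [hxa a ha]
          exact hz1 a
      · rw [mem_csupp, hxa r (hrf r hr)]
        exact mem_csupp.mp (hR hr)
      · by_cases ha : a = f
        · have hex : e ∈ csupp (x : E → ℤ) := by
            rw [mem_csupp] at hax ⊢
            intro h0
            exact hax (by rw [ha, hall x x.2, h0, mul_zero])
          obtain ⟨r, hr, η, hη, hηy⟩ := hlift e hef hex
          refine ⟨r, hr, ε * η, by linear_combination η * η * hε + hη, fun y hy => ?_⟩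
          rw [ha, hall y hy, hηy y hy, mul_assoc]
        · exact hlift a ha hax
    by_cases hloop : ∀ e ∈ F, t e ≠ h e
    swap
    · push Not at hloop
      obtain ⟨f, hf, hl⟩ := hloop
      refine ⟨Pi.single f 1, ⟨fun a ha => Pi.single_eq_of_ne (fun h => ha (by rw [h]; exact hf)) _,
        ?_⟩, ?_, ?_, csupp (Pi.single f 1), subset_rfl, ?_, ?_⟩
      · rw [bdry_single, hl, sub_self, smul_zero]
      · simp
      · intro a
        by_cases ha : a = f
        · subst ha
          simp
        · simp [ha]
      · refine (card_le_card (csupp_single_subset f 1)).trans ?_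
        rw [card_singleton]
        omega
      · exact fun a ha => ⟨a, ha, 1, one_mul 1, fun y _ => (one_mul _).symm⟩
    have hdeg := three_le_card_star hloop hlive hser
    by_contra hno
    have hno' : ∀ x ∈ cycleLattice t h F, (∀ e, |x e| ≤ 1) → x ≠ 0 →
        2 * Nat.log 2 k + 4 < #(csupp x) := by
      intro x hx hx1 hx0
      by_contra hle
      exact hno ⟨x, hx, hx0, hx1, csupp x, subset_rfl, not_lt.mp hle,
        fun a ha => ⟨a, ha, 1, one_mul 1, fun y _ => (one_mul _).symm⟩⟩
    -- There are at least 2^(⌊log₂ k⌋ + 2) > 2k vertices, whereas #F ≤ k + #V and 3 #V ≤ 2 #F give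
    -- #V ≤ 2k.
    have h1 := two_pow_le_card_verts (card_pos.mp (by omega)) hdeg hno'
      (s := Nat.log 2 k + 2) (by omega)
    have h2 := card_le_finrank_add_card_verts t h F
    have h3 : 3 * #(verts t h F) ≤ 2 * #F := by
      calc 3 * #(verts t h F) = ∑ v ∈ verts t h F, 3 := by rw [sum_const, smul_eq_mul, mul_comm]
        _ ≤ ∑ v ∈ verts t h F, #(star t h F v) := sum_le_sum hdeg
        _ = ∑ e ∈ F, #((verts t h F).filter fun v => t e = v ∨ h e = v) := sum_card_star t h F _
        _ ≤ ∑ e ∈ F, 2 := sum_le_sum fun e _ => card_filter_ends_le_two t h _ e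
        _ = 2 * #F := by rw [sum_const, smul_eq_mul, mul_comm]
    have h4 : k < 2 ^ (Nat.log 2 k + 1) := Nat.lt_pow_succ_log_self one_lt_two k
    rw [pow_succ] at h1
    omega

end Multigraph

/-! ### Gram determinants under deletion of an edge. -/

namespace Multigraph

open Finset

variable {V E : Type*} [DecidableEq V] [Fintype E] [DecidableEq E]

/-- The Gram matrix of a family of integral chains, for the scalar product `∑ w(e) x(e) y(e)`. -/
def gram {ι : Type*} (w : E → ℝ) (v : ι → E → ℤ) : Matrix ι ι ℝ :=
  Matrix.of fun i j => ∑ e, w e * (v i e : ℝ) * (v j e : ℝ)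

theorem det_gram_nonneg {ι : Type*} [Fintype ι] [DecidableEq ι] {w : E → ℝ} (hw : ∀ e, 0 ≤ w e)
    (v : ι → E → ℤ) : 0 ≤ (gram w v).det := by
  let M : Matrix ι E ℝ := Matrix.of fun i e => (v i e : ℝ)
  have h1 : gram w v = M * Matrix.diagonal w * M.conjTranspose := by
    ext i j
    rw [Matrix.mul_apply]
    simp only [gram, Matrix.of_apply, Matrix.mul_diagonal, Matrix.conjTranspose_apply, M,
      star_trivial]
    exact sum_congr rfl fun e _ => by ring
  rw [h1]
  exact ((Matrix.PosSemidef.diagonal hw).mul_mul_conjTranspose_same M).det_nonneg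

/-- The series class of `r`: the edges whose coefficient in all cycles agrees with that of `r`, up
to a sign. -/
noncomputable def seriesClass (t h : E → V) (F : Finset E) (r : E) : Finset E :=
  open Classical in
  univ.filter fun e => ∃ ε : ℤ, ε * ε = 1 ∧ ∀ y ∈ cycleLattice t h F, y e = ε * y r

omit [DecidableEq E] in
theorem mem_seriesClass {t h : E → V} {F : Finset E} {r e : E} : e ∈ seriesClass t h F r ↔
    ∃ ε : ℤ, ε * ε = 1 ∧ ∀ y ∈ cycleLattice t h F, y e = ε * y r := by
  simp [seriesClass]

/-- On cycles of `F` the series class of `r` contributes c·x(r)·y(r) to the form, where c is its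
total weight. A basis of the cycles vanishing at `r`, completed by one cycle `y`, therefore has a
Gram matrix in which this contribution affects only the corner entry; expanding the determinant
there isolates the Gram determinant of the smaller lattice. -/
theorem exists_basis_det_gram_ge {t h : E → V} {F : Finset E} {r : E} {w : E → ℝ}
    (hw : ∀ e, 0 ≤ w e) (hr : ∃ y ∈ cycleLattice t h F, y r ≠ 0) {k : ℕ}
    (b : Module.Basis (Fin k) ℤ (cycleLattice t h (F.erase r))) :
    ∃ b' : Module.Basis (Fin (k + 1)) ℤ (cycleLattice t h F),
      (∑ e ∈ seriesClass t h F r, w e) * (gram w fun i => (b i : E → ℤ)).det ≤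
        (gram w fun i => (b' i : E → ℤ)).det := by
  classical
  have hmem : ∀ z : E → ℤ, z ∈ cycleLattice t h (F.erase r) ↔
      z ∈ cycleLattice t h F ∧ z r = 0 := by
    intro z
    refine ⟨fun hz => ⟨⟨fun e he => hz.1 e fun h => he (mem_of_mem_erase h), hz.2⟩,
      hz.1 r (notMem_erase r F)⟩, fun hz => ⟨fun e he => ?_, hz.1.2⟩⟩
    by_cases her : e = r
    · exact her ▸ hz.2
    · exact hz.1.1 e fun h => he (mem_erase.mpr ⟨her, h⟩)
  -- The values of cycles at `r` form an ideal of `ℤ`; a cycle attaining its generator `m` completes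
  -- `b` to a basis.
  obtain ⟨m, hm⟩ := (IsPrincipalIdealRing.principal
    ((cycleLattice t h F).map (LinearMap.proj r : (E → ℤ) →ₗ[ℤ] ℤ) : Ideal ℤ)).principal
  obtain ⟨y, hy, hym⟩ : ∃ y ∈ cycleLattice t h F, y r = m := by
    have h1 : m ∈ (cycleLattice t h F).map (LinearMap.proj r : (E → ℤ) →ₗ[ℤ] ℤ) := by
      rw [hm]
      exact Submodule.mem_span_singleton_self m
    exact h1
  have hall : ∀ z ∈ cycleLattice t h F, ∃ a : ℤ, z r = a * m := by
    intro z hz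
    have h1 : z r ∈ (cycleLattice t h F).map (LinearMap.proj r : (E → ℤ) →ₗ[ℤ] ℤ) :=
      ⟨z, hz, rfl⟩
    rw [hm] at h1
    obtain ⟨a, ha⟩ := Submodule.mem_span_singleton.mp h1
    exact ⟨a, ha.symm⟩
  have hm0 : m ≠ 0 := by
    rintro rfl
    obtain ⟨z, hz, hz0⟩ := hr
    obtain ⟨a, ha⟩ := hall z hz
    exact hz0 (by rw [ha, mul_zero])
  have hle : cycleLattice t h (F.erase r) ≤ cycleLattice t h F := fun z hz => ((hmem z).mp hz).1
  let b' : Module.Basis (Fin (k + 1)) ℤ (cycleLattice t h F) := Module.Basis.mkFinConsOfLE y hy b hle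
    (by
      intro c x hx hc
      have h1 := congrFun hc r
      rw [Pi.add_apply, ((hmem x).mp hx).2, add_zero, Pi.smul_apply, hym, smul_eq_mul] at h1
      exact (mul_eq_zero.mp h1).resolve_right hm0)
    (by
      intro z hz
      obtain ⟨a, ha⟩ := hall z hz
      refine ⟨-a, (hmem _).mpr ⟨add_mem hz (Submodule.smul_mem _ _ hy), ?_⟩⟩
      rw [Pi.add_apply, Pi.smul_apply, ha, hym, smul_eq_mul]
      ring)
  refine ⟨b', ?_⟩
  have hb0 : (b' 0 : E → ℤ) = y := by simp [b']
  have hbs : ∀ i : Fin k, (b' i.succ : E → ℤ) = b i := fun i => by simp [b']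
  have hbr : ∀ i : Fin k, (b' i.succ : E → ℤ) r = 0 := fun i => by
    rw [hbs]
    exact ((hmem _).mp (b i).2).2
  set P := seriesClass t h F r with hP
  set c : ℝ := ∑ e ∈ P, w e with hc
  have hc0 : 0 ≤ c := sum_nonneg fun e _ => hw e
  set w' : E → ℝ := fun e => if e ∈ P then 0 else w e with hw'
  have hw'0 : ∀ e, 0 ≤ w' e := fun e => by
    simp only [hw']
    split_ifs
    exacts [le_rfl, hw e]
  have hsplit : ∀ i j, gram w (fun i => (b' i : E → ℤ)) i j =
      gram w' (fun i => (b' i : E → ℤ)) i j +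
        c * ((b' i : E → ℤ) r : ℝ) * ((b' j : E → ℤ) r : ℝ) := by
    intro i j
    have h1 : c * ((b' i : E → ℤ) r : ℝ) * ((b' j : E → ℤ) r : ℝ) =
        ∑ e, if e ∈ P then w e * ((b' i : E → ℤ) e : ℝ) * ((b' j : E → ℤ) e : ℝ) else 0 := by
      rw [← sum_filter, filter_mem_eq_inter, univ_inter, hc, sum_mul, sum_mul]
      refine sum_congr rfl fun e he => ?_
      obtain ⟨ε, hε, hey⟩ := mem_seriesClass.mp he
      have hε' : (ε : ℝ) * ε = 1 := by exact_mod_cast hε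
      rw [hey _ (b' i).2, hey _ (b' j).2]
      push_cast
      linear_combination (-w e * ((b' i : E → ℤ) r : ℝ) * ((b' j : E → ℤ) r : ℝ)) * hε'
    rw [h1]
    simp only [gram, Matrix.of_apply]
    rw [← sum_add_distrib]
    refine sum_congr rfl fun e _ => ?_
    by_cases he : e ∈ P <;> simp [hw', he]
  set A := gram w fun i => (b' i : E → ℤ)
  set B := gram w' fun i => (b' i : E → ℤ) with hB
  have hA : A = B.updateRow 0 (B 0 + (c * m * m) • Pi.single 0 1) := by
    ext i j
    rw [hsplit]
    refine Fin.cases ?_ (fun i => ?_) i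
    · rw [Matrix.updateRow_self, Pi.add_apply, Pi.smul_apply, hb0, hym, smul_eq_mul]
      refine Fin.cases ?_ (fun j => ?_) j
      · rw [hb0, hym, Pi.single_eq_same, mul_one]
      · rw [hbr, Pi.single_eq_of_ne (Fin.succ_ne_zero j)]
        simp
    · rw [Matrix.updateRow_ne (Fin.succ_ne_zero i), hbr]
      simp
  have hdet : A.det = B.det + c * m * m * (B.submatrix Fin.succ Fin.succ).det := by
    rw [hA, Matrix.det_updateRow_add, Matrix.updateRow_eq_self, Matrix.det_updateRow_smul,
      ← Matrix.adjugate_apply, Matrix.adjugate_fin_succ_eq_det_submatrix]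
    simp
  -- The remaining basis cycles vanish at `r`, so removing the weights of its series class does not
  -- change their products.
  have hsub : B.submatrix Fin.succ Fin.succ = gram w fun i => (b i : E → ℤ) := by
    ext i j
    have h1 := hsplit i.succ j.succ
    rw [hbr, hbr, Int.cast_zero, mul_zero, add_zero] at h1
    rw [Matrix.submatrix_apply, ← h1]
    simp only [A, gram, Matrix.of_apply, hbs]
  rw [hdet, hsub]
  have h1 := det_gram_nonneg hw'0 fun i => (b' i : E → ℤ)
  have h2 := det_gram_nonneg hw fun i => (b i : E → ℤ)
  have h3 : (1 : ℝ) ≤ m * m := by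
    have : 1 ≤ m * m := Int.add_one_le_iff.mpr (mul_self_pos.mpr hm0)
    exact_mod_cast this
  have h4 := mul_nonneg (mul_nonneg hc0 h2) (sub_nonneg.mpr h3)
  rw [← hB] at h1
  linarith

omit [DecidableEq V] [DecidableEq E] in
theorem sum_sq_eq_sum_csupp {x : E → ℤ} (hx : ∀ e, |x e| ≤ 1) (w : E → ℝ) :
    ∑ e, w e * (x e : ℝ) * (x e : ℝ) = ∑ e ∈ csupp x, w e := by
  rw [csupp, sum_filter]
  refine sum_congr rfl fun e _ => ?_
  have h1 := hx e
  rw [abs_le] at h1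
  obtain h2 | h2 | h2 : x e = -1 ∨ x e = 0 ∨ x e = 1 := by omega
  all_goals simp [h2]

/-- If all simple cycles have length at least `s`, the cycle lattice has a large determinant. -/
theorem exists_basis_pow_le_det_gram (t h : E → V) {w : E → ℝ} (hw : ∀ e, 0 ≤ w e) {s : ℝ}
    (hs0 : 0 ≤ s) {n : ℕ} (hs : ∀ x ∈ cycleLattice t h univ, x ≠ 0 → (∀ e, |x e| ≤ 1) →
      s ≤ ∑ e, w e * (x e : ℝ) * (x e : ℝ)) :
    ∀ k ≤ n, ∀ F : Finset E, Module.finrank ℤ (cycleLattice t h F) = k →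
      ∃ b : Module.Basis (Fin k) ℤ (cycleLattice t h F),
        (s / (2 * Nat.log 2 n + 4 : ℕ)) ^ k ≤ (gram w fun i => (b i : E → ℤ)).det := by
  classical
  -- Only the rank `k` varies in the induction; `n` is fixed, so every step loses the same factor
  -- s/G.
  intro k
  induction k with
  | zero =>
    intro _ F hF
    exact ⟨Module.finBasisOfFinrankEq ℤ _ hF, by simp⟩
  | succ k ih =>
    intro hk F hF
    have hne : cycleLattice t h F ≠ ⊥ := by
      intro hbot
      rw [hbot, finrank_bot] at hF
      omega
    obtain ⟨x, hx, hx0, hx1, R, hR, hRc, hRx⟩ :=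
      exists_short_cycle n _ t h F rfl hne (hF.trans_le hk)
    have hxs := hs x ⟨fun e he => (he (mem_univ e)).elim, hx.2⟩ hx0 hx1
    rw [sum_sq_eq_sum_csupp hx1] at hxs
    have hRne : R.Nonempty := by
      obtain ⟨e, he⟩ := Function.ne_iff.mp hx0
      obtain ⟨r, hr, -⟩ := hRx e (mem_csupp.mpr he)
      exact ⟨r, hr⟩
    have hcover : ∑ e ∈ csupp x, w e ≤ ∑ r ∈ R, ∑ e ∈ seriesClass t h F r, w e := by
      calc ∑ e ∈ csupp x, w e ≤ ∑ e ∈ csupp x, ∑ r ∈ R,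
            (if e ∈ seriesClass t h F r then w e else 0) := by
            refine sum_le_sum fun e he => ?_
            obtain ⟨r, hr, hre⟩ := hRx e he
            refine le_trans ?_ (single_le_sum (fun r _ => ?_) hr)
            · rw [if_pos (mem_seriesClass.mpr hre)]
            · split_ifs
              exacts [hw e, le_rfl]
        _ ≤ ∑ e, ∑ r ∈ R, (if e ∈ seriesClass t h F r then w e else 0) := by
            refine sum_le_sum_of_subset_of_nonneg (subset_univ _) fun e _ _ =>
              sum_nonneg fun r _ => ?_
            split_ifs
            exacts [hw e, le_rfl]
        _ = ∑ r ∈ R, ∑ e ∈ seriesClass t h F r, w e := by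
            rw [sum_comm]
            refine sum_congr rfl fun r _ => ?_
            rw [← sum_filter, filter_mem_eq_inter, univ_inter]
    set G : ℕ := 2 * Nat.log 2 n + 4
    have hG : (0 : ℝ) < G := by positivity
    -- Pigeonhole: at most G classes cover a cycle of length at least s.
    obtain ⟨r, hr, hrs⟩ : ∃ r ∈ R, s / G ≤ ∑ e ∈ seriesClass t h F r, w e := by
      refine exists_le_of_sum_le hRne ?_
      rw [sum_const, nsmul_eq_mul]
      refine le_trans ?_ (hxs.trans hcover)
      rw [mul_div_left_comm]
      refine mul_le_of_le_one_right hs0 ((div_le_one hG).mpr ?_)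
      exact_mod_cast hRc
    have hlive : ∃ y ∈ cycleLattice t h F, y r ≠ 0 := ⟨x, hx, mem_csupp.mp (hR hr)⟩
    -- That the rank drops by exactly one is read off from the extension of an arbitrary basis.
    have hfin : Module.finrank ℤ (cycleLattice t h (F.erase r)) = k := by
      obtain ⟨b, -⟩ := exists_basis_det_gram_ge hw hlive
        (Module.finBasisOfFinrankEq ℤ (cycleLattice t h (F.erase r)) rfl)
      have := Module.finrank_eq_card_basis b
      rw [hF, Fintype.card_fin] at this
      omega
    obtain ⟨b, hb⟩ := ih (Nat.le_of_succ_le hk) _ hfin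
    obtain ⟨b', hb'⟩ := exists_basis_det_gram_ge hw hlive b
    refine ⟨b', le_trans ?_ hb'⟩
    rw [pow_succ, mul_comm]
    exact mul_le_mul hrs hb (by positivity) (sum_nonneg fun e _ => hw e)

end Multigraph

/-! ### The upper bound for the Hermite invariant. -/

open Multigraph in
theorem OrientedGraph.cycleLattice_univ (Γ : OrientedGraph) :
    cycleLattice Γ.tail Γ.head Finset.univ = Γ.homology ℤ := by
  have h1 : bdry Γ.tail Γ.head = Γ.boundary ℤ := by
    refine LinearMap.ext fun x => funext fun v => ?_
    rw [bdry_apply, OrientedGraph.boundary_apply]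
  ext x
  rw [OrientedGraph.homology, LinearMap.mem_ker, ← h1]
  exact ⟨fun hx => hx.2, fun hx => ⟨fun e he => (he (Finset.mem_univ e)).elim, hx⟩⟩

theorem latticeMinNorm_nonneg {E : Type*} [NormedAddCommGroup E] [InnerProductSpace ℝ E]
    (L : Submodule ℤ E) : 0 ≤ latticeMinNorm L := by
  refine Real.sInf_nonneg ?_
  rintro r ⟨x, -, -, rfl⟩
  exact real_inner_self_nonneg

theorem latticeMinNorm_le {E : Type*} [NormedAddCommGroup E] [InnerProductSpace ℝ E]
    {L : Submodule ℤ E} {x : E} (hx : x ∈ L) (hx0 : x ≠ 0) : latticeMinNorm L ≤ inner ℝ x x := by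
  refine csInf_le ⟨0, ?_⟩ ⟨x, hx, hx0, rfl⟩
  rintro r ⟨y, -, -, rfl⟩
  exact real_inner_self_nonneg

open Multigraph in
theorem WeightedGraph.hermiteInvariant_jacobian_le (Γ : WeightedGraph) (hb : 1 ≤ Γ.betti) :
    hermiteInvariant Γ.jacobian ≤ (2 * Nat.log 2 Γ.betti + 4 : ℕ) := by
  have hmin : ∀ x ∈ cycleLattice Γ.tail Γ.head Finset.univ, x ≠ 0 → (∀ e, |x e| ≤ 1) →
      latticeMinNorm Γ.jacobian ≤ ∑ e, Γ.w e * (x e : ℝ) * (x e : ℝ) := by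
    intro x hx hx0 _
    rw [Γ.cycleLattice_univ] at hx
    refine latticeMinNorm_le (x := Γ.ofInt ⟨x, hx⟩) ?_ fun h0 => hx0 (funext fun e => ?_)
    · rw [← Γ.range_ofInt]
      exact ⟨_, rfl⟩
    · have h1 := Γ.toChain_ofInt ⟨x, hx⟩ e
      rw [h0, map_zero] at h1
      exact Int.cast_eq_zero.mp h1.symm
  have hfin : Module.finrank ℤ (cycleLattice Γ.tail Γ.head Finset.univ) = Γ.betti := by
    rw [Γ.cycleLattice_univ, Γ.betti_eq_finrank_int]
  obtain ⟨b, hbd⟩ := exists_basis_pow_le_det_gram Γ.tail Γ.head Γ.w_nonneg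
    (latticeMinNorm_nonneg Γ.jacobian) hmin _ le_rfl _ hfin
  have hdet : latticeDet Γ.jacobian = (gram Γ.w fun i => (b i : Γ.Edge → ℤ)).det :=
    Γ.latticeDet_jacobian (b.map (LinearEquiv.ofEq _ _ Γ.cycleLattice_univ))
  rw [← hdet] at hbd
  set G : ℕ := 2 * Nat.log 2 Γ.betti + 4
  have hG : (0 : ℝ) < G := by positivity
  have hroot := Real.rpow_le_rpow (pow_nonneg (div_nonneg (latticeMinNorm_nonneg Γ.jacobian) hG.le)
    Γ.betti) hbd (by positivity : (0 : ℝ) ≤ 1 / (Γ.betti : ℝ))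
  rw [one_div, Real.pow_rpow_inv_natCast (div_nonneg (latticeMinNorm_nonneg Γ.jacobian) hG.le)
    (by omega), div_le_iff₀ hG] at hroot
  have hpos := Γ.latticeDet_jacobian_pos
  rw [hermiteInvariant, div_le_iff₀ (Real.rpow_pos_of_pos hpos _), mul_comm, one_div]
  exact hroot

/-! ### Jacobians of unweighted graphs -/

/-- The arithmetic-geometric mean inequality for the eigenvalues. -/
theorem Matrix.PosSemidef.det_le_pow {n : Type*} [Fintype n] [DecidableEq n] {A : Matrix n n ℝ}
    (hA : A.PosSemidef) {c : ℝ} (hc : 0 < c) (h : ∀ i, A i i ≤ c) : A.det ≤ c ^ Fintype.card n := by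
  have h1 : ∑ i, hA.isHermitian.eigenvalues i ≤ Fintype.card n * c := by
    have h2 := hA.isHermitian.trace_eq_sum_eigenvalues
    simp only [RCLike.ofReal_real_eq_id, id] at h2
    rw [← h2, Matrix.trace]
    exact (Finset.sum_le_sum fun i _ => h i).trans_eq (by simp)
  -- The inequality x ≤ exp(x - 1), applied to each eigenvalue divided by c, reduces the product to
  -- the trace.
  have h3 : ∏ i, (hA.isHermitian.eigenvalues i / c) ≤ 1 := by
    calc ∏ i, (hA.isHermitian.eigenvalues i / c)
        ≤ ∏ i, Real.exp (hA.isHermitian.eigenvalues i / c - 1) :=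
          Finset.prod_le_prod (fun i _ => div_nonneg (hA.eigenvalues_nonneg i) hc.le) fun i _ => by
            simpa using Real.add_one_le_exp (hA.isHermitian.eigenvalues i / c - 1)
      _ = Real.exp (∑ i, (hA.isHermitian.eigenvalues i / c - 1)) := (Real.exp_sum _ _).symm
      _ ≤ 1 := by
          rw [Real.exp_le_one_iff, Finset.sum_sub_distrib, ← Finset.sum_div, sub_nonpos,
            div_le_iff₀ hc]
          simpa using h1
  rw [Finset.prod_div_distrib, Finset.prod_const, Finset.card_univ, div_le_one (by positivity)] at h3
  have h4 := hA.isHermitian.det_eq_prod_eigenvalues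
  simp only [RCLike.ofReal_real_eq_id, id] at h4
  rw [h4]
  exact h3

/-! ### The determinant of the kernel of an integral matrix. -/

section Kernel

variable {m E : Type*} [Fintype m] [DecidableEq m] [Fintype E] [DecidableEq E]

omit [DecidableEq E] in
theorem det_mul_transpose_nonneg (D : Matrix m E ℤ) : 0 ≤ (D * D.transpose).det := by
  have h1 := (Matrix.posSemidef_self_mul_conjTranspose (D.map (Int.castRingHom ℝ))).det_nonneg
  have h2 : D.map (Int.castRingHom ℝ) * (D.map (Int.castRingHom ℝ)).conjTranspose =
      (D * D.transpose).map (Int.castRingHom ℝ) := by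
    rw [Matrix.map_mul, Matrix.transpose_map]
    rfl
  rw [h2, ← RingHom.mapMatrix_apply, ← RingHom.map_det] at h1
  exact Int.cast_nonneg_iff.mp h1

-- The range of `D` has full rank because it contains the image of the nonsingular matrix `D *
-- D.transpose`.
omit [DecidableEq E] in
theorem finrank_ker_add_card {D : Matrix m E ℤ} (hD : (D * D.transpose).det ≠ 0) :
    Module.finrank ℤ (LinearMap.ker D.mulVecLin) + Fintype.card m = Fintype.card E := by
  have h1 := Submodule.finrank_quotient_add_finrank (LinearMap.ker D.mulVecLin)
  rw [D.mulVecLin.quotKerEquivRange.finrank_eq, Module.finrank_fintype_fun_eq_card] at h1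
  have h2 := Submodule.finrank_le (LinearMap.range D.mulVecLin)
  rw [Module.finrank_fintype_fun_eq_card] at h2
  have hinj : Function.Injective (D.mulVecLin.rangeRestrict ∘ₗ D.transpose.mulVecLin) := by
    rw [← LinearMap.ker_eq_bot, LinearMap.ker_eq_bot']
    intro y hy
    have h3 : D.mulVec (D.transpose.mulVec y) = 0 := congrArg Subtype.val hy
    rw [Matrix.mulVec_mulVec] at h3
    exact Matrix.eq_zero_of_mulVec_eq_zero hD h3
  have h3 := LinearMap.finrank_le_finrank_of_injective hinj
  rw [Module.finrank_fintype_fun_eq_card] at h3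
  omega

-- The range of `D` lies in a free `ℤ`-module, hence is projective, so the kernel is a direct
-- summand.
omit [Fintype m] [DecidableEq m] [DecidableEq E] in
theorem exists_retraction_ker (D : Matrix m E ℤ) :
    ∃ π : (E → ℤ) →ₗ[ℤ] LinearMap.ker D.mulVecLin, ∀ x : LinearMap.ker D.mulVecLin, π x = x := by
  obtain ⟨s, hs⟩ := Module.projective_lifting_property D.mulVecLin.rangeRestrict LinearMap.id
    D.mulVecLin.surjective_rangeRestrict
  have hs' : ∀ y, D.mulVecLin (s y) = y := fun y => congrArg Subtype.val (LinearMap.congr_fun hs y)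
  have hmem : ∀ x, (LinearMap.id - s ∘ₗ D.mulVecLin.rangeRestrict : (E → ℤ) →ₗ[ℤ] E → ℤ) x ∈
      LinearMap.ker D.mulVecLin := by
    intro x
    rw [LinearMap.mem_ker, LinearMap.sub_apply, map_sub, LinearMap.comp_apply, hs']
    exact sub_self _
  refine ⟨(LinearMap.id - s ∘ₗ D.mulVecLin.rangeRestrict).codRestrict _ hmem, fun x => ?_⟩
  refine Subtype.ext ?_
  have h1 : D.mulVecLin.rangeRestrict (x : E → ℤ) = 0 := Subtype.ext x.2
  rw [LinearMap.codRestrict_apply, LinearMap.sub_apply, LinearMap.comp_apply, h1, map_zero,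
    sub_zero, LinearMap.id_apply]

/-- The determinant of the lattice of integral solutions of `D x = 0` is at most that of the
lattice spanned by the rows of `D`. -/
theorem det_basis_ker_le {D : Matrix m E ℤ} (hD : (D * D.transpose).det ≠ 0) {k : ℕ}
    (b : Module.Basis (Fin k) ℤ (LinearMap.ker D.mulVecLin)) :
    ((Matrix.of fun i => (b i : E → ℤ)) * (Matrix.of fun i => (b i : E → ℤ)).transpose).det ≤
      (D * D.transpose).det := by
  obtain ⟨π, hπ⟩ := exists_retraction_ker D
  set Z : Matrix (Fin k) E ℤ := Matrix.of fun i => (b i : E → ℤ)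
  let P : Matrix (Fin k) E ℤ := LinearMap.toMatrix' (b.equivFun.toLinearMap ∘ₗ π)
  have hPZ : P * Z.transpose = 1 := by
    ext i j
    have h1 : (P * Z.transpose) i j = P.mulVec (b j : E → ℤ) i := rfl
    rw [h1, LinearMap.toMatrix'_mulVec, LinearMap.comp_apply, hπ]
    simp [Matrix.one_apply, eq_comm]
  have hDZ : D * Z.transpose = 0 := by
    ext i j
    exact congrFun (LinearMap.mem_ker.mp (b j).2) i
  have hZD : Z * D.transpose = 0 := by
    rw [← Matrix.transpose_transpose Z, ← Matrix.transpose_mul, hDZ, Matrix.transpose_zero]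
  have hcard : Fintype.card E = Fintype.card (Fin k ⊕ m) := by
    rw [Fintype.card_sum, ← finrank_ker_add_card hD, Module.finrank_eq_card_basis b]
  let σ := Fintype.equivOfCardEq hcard
  let M : Matrix (Fin k ⊕ m) (Fin k ⊕ m) ℤ :=
    (Matrix.fromCols Z.transpose D.transpose).submatrix σ.symm id
  -- With Δ = det(DDᵀ), the product of (P; D) and M = (Zᵀ Dᵀ) is block triangular with determinant
  -- Δ, while MᵀM is block diagonal. Thus a·det M = Δ and (det M)² = det(ZZᵀ)·Δ for a nonzero
  -- integer a, so det(ZZᵀ)·Δ ≤ Δ².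
  have h1 : ((Matrix.fromRows P D).submatrix id σ.symm).det * M.det = (D * D.transpose).det := by
    rw [← Matrix.det_mul, Matrix.submatrix_mul_equiv, Matrix.fromRows_mul_fromCols, hPZ, hDZ,
      Matrix.submatrix_id_id, Matrix.det_fromBlocks_zero₂₁, Matrix.det_one, one_mul]
  have h2 : M.det * M.det = (Z * Z.transpose).det * (D * D.transpose).det := by
    have h3 : M.transpose = (Matrix.fromRows Z D).submatrix id σ.symm := by
      rw [Matrix.transpose_submatrix, Matrix.transpose_fromCols, Matrix.transpose_transpose,
        Matrix.transpose_transpose]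
    calc M.det * M.det = (M.transpose * M).det := by rw [Matrix.det_mul, Matrix.det_transpose]
      _ = _ := by
        rw [h3, Matrix.submatrix_mul_equiv, Matrix.fromRows_mul_fromCols, hDZ, hZD,
          Matrix.submatrix_id_id, Matrix.det_fromBlocks_zero₂₁]
  have h4 := lt_of_le_of_ne (det_mul_transpose_nonneg D) hD.symm
  set a := ((Matrix.fromRows P D).submatrix id σ.symm).det
  have ha : a ≠ 0 := fun h => hD (by rw [← h1, h, zero_mul])
  have ha2 : 1 ≤ a * a := Int.add_one_le_iff.mpr (mul_self_pos.mpr ha)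
  refine le_of_mul_le_mul_right ?_ h4
  calc _ = 1 * (M.det * M.det) := by rw [h2, one_mul]
    _ ≤ (a * a) * (M.det * M.det) := mul_le_mul_of_nonneg_right ha2 (mul_self_nonneg _)
    _ = _ := by rw [← h1]; ring

end Kernel

/-! ### The reduced incidence matrix. -/

namespace OrientedGraph

variable (Γ : OrientedGraph)

theorem tail_ne_head (e : Γ.Edge) : Γ.tail e ≠ Γ.head e := by
  have h := e.2
  rw [Γ.edge_eq e, SimpleGraph.mem_edgeSet] at h
  exact h.ne

/-- The incidence matrix without the row of the vertex `r`. -/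
def incidence (r : Γ.V) : Matrix {v // v ≠ r} Γ.Edge ℤ :=
  Matrix.of fun v e => (if Γ.head e = v then 1 else 0) - (if Γ.tail e = v then 1 else 0)

theorem sum_boundary (x : Γ.Edge → ℤ) : ∑ v, Γ.boundary ℤ x v = 0 := by
  simp only [boundary_apply]
  rw [Finset.sum_comm]
  refine Finset.sum_eq_zero fun e _ => ?_
  rw [← Finset.mul_sum, Finset.sum_sub_distrib]
  simp

theorem ker_incidence (r : Γ.V) : LinearMap.ker (Γ.incidence r).mulVecLin = Γ.homology ℤ := by
  have h1 : ∀ x (v : {v // v ≠ r}), (Γ.incidence r).mulVecLin x v = Γ.boundary ℤ x v := by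
    intro x v
    rw [boundary_apply, Matrix.mulVecLin_apply, Matrix.mulVec, dotProduct]
    exact Finset.sum_congr rfl fun e _ => mul_comm _ _
  ext x
  rw [homology, LinearMap.mem_ker, LinearMap.mem_ker]
  constructor
  · intro hx
    have h2 : ∀ v, v ≠ r → Γ.boundary ℤ x v = 0 := fun v hv => by
      rw [← h1 x ⟨v, hv⟩, hx]
      rfl
    funext v
    by_cases hv : v = r
    · have h3 := Γ.sum_boundary x
      rw [Finset.sum_eq_single r (fun u _ hu => h2 u hu)
        fun h => (h (Finset.mem_univ r)).elim] at h3
      rw [hv, h3]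
      rfl
    · exact h2 v hv
  · intro hx
    funext v
    rw [h1, hx]
    rfl

/-- A relation between the rows, extended by 0 at `r`, is a function on the vertices that is
constant along edges; connectedness makes it zero. -/
theorem det_incidence_ne_zero (r : Γ.V) :
    (Γ.incidence r * (Γ.incidence r).transpose).det ≠ 0 := by
  have hli : LinearIndependent ℤ (fun v => Γ.incidence r v) := by
    rw [Fintype.linearIndependent_iff]
    intro c hc
    let c' : Γ.V → ℤ := fun v => if h : v ≠ r then c ⟨v, h⟩ else 0
    have hsum : ∀ u : Γ.V, ∑ v : {v // v ≠ r}, c v * (if u = v then 1 else 0) = c' u := by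
      intro u
      by_cases hu : u ≠ r
      · rw [Finset.sum_eq_single ⟨u, hu⟩]
        · simp [c', hu]
        · intro v _ hv
          rw [if_neg fun h => hv (Subtype.ext h.symm), mul_zero]
        · exact fun h => (h (Finset.mem_univ _)).elim
      · refine (Finset.sum_eq_zero fun v _ => ?_).trans (by simp [c', hu])
        rw [if_neg fun h : u = v => hu (h ▸ v.2), mul_zero]
    have hedge : ∀ e, c' (Γ.head e) = c' (Γ.tail e) := by
      intro e
      have h1 := congrFun hc e
      rw [Finset.sum_apply] at h1
      simp only [Pi.smul_apply, incidence, Matrix.of_apply, smul_eq_mul, mul_sub,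
        Finset.sum_sub_distrib, hsum, Pi.zero_apply] at h1
      exact sub_eq_zero.mp h1
    have hadj : ∀ u v, Γ.G.Adj u v → c' u = c' v := by
      intro u v huv
      have h1 := hedge ⟨s(u, v), huv⟩
      have h2 := Γ.edge_eq ⟨s(u, v), huv⟩
      rcases Sym2.eq_iff.mp h2 with ⟨h3, h4⟩ | ⟨h3, h4⟩
      · rw [← h3, ← h4] at h1
        exact h1.symm
      · rw [← h3, ← h4] at h1
        exact h1
    intro v
    obtain ⟨p⟩ := Γ.connected.preconnected v.1 r
    have h1 : ∀ {a b} (_ : Γ.G.Walk a b), c' a = c' b := by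
      intro a b p
      induction p with
      | nil => rfl
      | cons h _ ih => exact (hadj _ _ h).trans ih
    have h2 := h1 p
    simpa [c', v.2] using h2
  exact det_mul_transpose_ne_zero hli

theorem incidence_diag_le (r : Γ.V) (v : {v // v ≠ r}) :
    (Γ.incidence r * (Γ.incidence r).transpose) v v ≤ Γ.G.degree v := by
  have h1 : (Γ.incidence r * (Γ.incidence r).transpose) v v ≤
      ∑ e : Γ.Edge, if (v : Γ.V) ∈ e.1 then (1 : ℤ) else 0 := by
    rw [Matrix.mul_apply]
    refine Finset.sum_le_sum fun e _ => ?_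
    have h2 : (v : Γ.V) ∈ e.1 ↔ (v : Γ.V) = Γ.tail e ∨ (v : Γ.V) = Γ.head e := by
      rw [Γ.edge_eq e, Sym2.mem_iff]
    simp only [h2, Matrix.transpose_apply, incidence, Matrix.of_apply]
    split_ifs <;> simp_all
  refine h1.trans ?_
  rw [Finset.sum_boole, ← Γ.G.card_incidenceFinset_eq_degree]
  refine Nat.cast_le.mpr (Finset.card_le_card_of_injOn Subtype.val (fun e he => ?_)
    Subtype.val_injective.injOn)
  rw [Finset.coe_filter, Set.mem_ofPred_eq] at he
  rw [Finset.mem_coe, SimpleGraph.mem_incidenceFinset]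
  exact ⟨e.2, he.2⟩

theorem betti_add_card : Γ.betti + Fintype.card Γ.V = Fintype.card Γ.Edge + 1 := by
  obtain ⟨r⟩ := Γ.connected.nonempty
  have h1 := finrank_ker_add_card (Γ.det_incidence_ne_zero r)
  rw [Γ.ker_incidence, ← Γ.betti_eq_finrank_int] at h1
  have h2 : Fintype.card {v // v ≠ r} = Fintype.card Γ.V - 1 := by
    rw [Fintype.card_subtype_compl, Fintype.card_subtype_eq]
  have h3 : 0 < Fintype.card Γ.V := Fintype.card_pos_iff.mpr ⟨r⟩
  omega

end OrientedGraph

/-- The determinant of the Jacobian of an unweighted graph of maximal degree `d`. -/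
theorem WeightedGraph.latticeDet_jacobian_le (Γ : WeightedGraph) (hw : ∀ e, Γ.w e = 1) {d : ℕ}
    (hd0 : 0 < d) (hd : ∀ v, Γ.G.degree v ≤ d) :
    latticeDet Γ.jacobian ≤ (d : ℝ) ^ (Fintype.card Γ.V - 1) := by
  obtain ⟨r⟩ := Γ.connected.nonempty
  let z := Module.finBasisOfFinrankEq ℤ (LinearMap.ker (Γ.incidence r).mulVecLin) rfl
  have h1 := det_basis_ker_le (Γ.det_incidence_ne_zero r) z
  have h2 : ((Γ.incidence r * (Γ.incidence r).transpose).det : ℝ) ≤ (d : ℝ) ^ (Fintype.card Γ.V - 1) := by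
    -- The reduced Laplacian is positive semidefinite of size |V| - 1, with diagonal entries bounded
    -- by the degrees.
    have h3 := Matrix.posSemidef_self_mul_conjTranspose ((Γ.incidence r).map (Int.castRingHom ℝ))
    have h4 : (Γ.incidence r).map (Int.castRingHom ℝ) * ((Γ.incidence r).map (Int.castRingHom ℝ)).conjTranspose =
        (Γ.incidence r * (Γ.incidence r).transpose).map (Int.castRingHom ℝ) := by
      rw [Matrix.map_mul, Matrix.transpose_map]
      rfl
    rw [h4] at h3
    have h5 := h3.det_le_pow (c := d) (by exact_mod_cast hd0) fun v => by
      rw [Matrix.map_apply]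
      have := (Γ.incidence_diag_le r v).trans (Int.ofNat_le.mpr (hd v))
      exact (Int.cast_le (R := ℝ).mpr this).trans_eq (Int.cast_natCast d)
    rw [← RingHom.mapMatrix_apply, ← RingHom.map_det, Fintype.card_subtype_compl,
      Fintype.card_subtype_eq] at h5
    exact h5
  refine le_trans (le_of_eq ?_) ((Int.cast_le.mpr h1).trans h2)
  rw [Γ.latticeDet_jacobian (z.map (LinearEquiv.ofEq _ _ (Γ.ker_incidence r)))]
  refine Eq.trans ?_ (RingHom.map_det (Int.castRingHom ℝ) _).symm
  congr 1
  ext i j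
  simp [Matrix.mul_apply, hw]

/-! ### Graphs of large girth -/

namespace SimpleGraph

open Finset

variable {V : Type*}

/-- All cycles of `G` have length at least `g`: the end points of an edge cannot be joined by a walk
of length less than `g - 1` which avoids this edge. -/
def GirthGE (G : SimpleGraph V) (g : ℕ) : Prop :=
  ∀ u v, G.Adj u v → ∀ p : (G \ edge u v).Walk u v, g ≤ p.length + 1

theorem GirthGE.anti {G H : SimpleGraph V} {g : ℕ} (hH : H.GirthGE g) (hGH : G ≤ H) :
    G.GirthGE g := fun u v huv p => by
  simpa using hH u v (hGH huv) (p.mapLe (sdiff_le_sdiff_right hGH))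

/-- A walk can be shortened so as to use the added edge at most once, in one of its two directions.
-/
theorem Walk.exists_of_sup_edge {K : SimpleGraph V} {u v : V} {a b : V}
    (p : (K ⊔ edge u v).Walk a b) :
    (∃ q : K.Walk a b, q.length ≤ p.length) ∨
    (∃ (q : K.Walk a u) (q' : K.Walk v b), q.length + q'.length + 1 ≤ p.length) ∨
    (∃ (q : K.Walk a v) (q' : K.Walk u b), q.length + q'.length + 1 ≤ p.length) := by
  induction p with
  | nil => exact Or.inl ⟨Walk.nil, le_rfl⟩
  | @cons a c b h p ih =>
    rw [Walk.length_cons]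
    by_cases hK : K.Adj a c
    · rcases ih with ⟨q, hq⟩ | ⟨q, q', hq⟩ | ⟨q, q', hq⟩
      · exact Or.inl ⟨Walk.cons hK q, by rw [Walk.length_cons]; omega⟩
      · exact Or.inr (Or.inl ⟨Walk.cons hK q, q', by rw [Walk.length_cons]; omega⟩)
      · exact Or.inr (Or.inr ⟨Walk.cons hK q, q', by rw [Walk.length_cons]; omega⟩)
    · have he : (edge u v).Adj a c := (sup_adj _ _ _ _).mp h |>.resolve_left hK
      rw [edge_adj] at he
      rcases he with ⟨⟨rfl, rfl⟩ | ⟨rfl, rfl⟩, -⟩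
      · rcases ih with ⟨q, hq⟩ | ⟨q, q', hq⟩ | ⟨q, q', hq⟩
        · exact Or.inr (Or.inl ⟨Walk.nil, q, by rw [Walk.length_nil]; omega⟩)
        · exact Or.inr (Or.inl ⟨Walk.nil, q', by rw [Walk.length_nil]; omega⟩)
        · exact Or.inl ⟨q', by omega⟩
      · rcases ih with ⟨q, hq⟩ | ⟨q, q', hq⟩ | ⟨q, q', hq⟩
        · exact Or.inr (Or.inr ⟨Walk.nil, q, by rw [Walk.length_nil]; omega⟩)
        · exact Or.inl ⟨q', by omega⟩
        · exact Or.inr (Or.inr ⟨Walk.nil, q', by rw [Walk.length_nil]; omega⟩)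

/-- A new cycle through an old edge `ab` uses `uv`. The rest of it, run through `ab`, is a walk of
`G` from `u` to `v`, which is long by hypothesis. -/
theorem GirthGE.sup_edge {G : SimpleGraph V} {g : ℕ} (hG : G.GirthGE g) {u v : V}
    (huv : ∀ p : G.Walk u v, g ≤ p.length + 1) : (G ⊔ edge u v).GirthGE g := by
  intro a b hab p
  by_cases he : s(a, b) = s(u, v)
  · have hle : (G ⊔ edge u v) \ edge a b ≤ G := by
      intro x y hxy
      rw [sdiff_adj, sup_adj, edge, edge, he] at hxy
      exact hxy.1.resolve_right hxy.2
    rcases Sym2.eq_iff.mp he with ⟨rfl, rfl⟩ | ⟨rfl, rfl⟩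
    · simpa using huv (p.mapLe hle)
    · simpa using huv (p.mapLe hle).reverse
  · have hGab : G.Adj a b := by
      refine ((sup_adj _ _ _ _).mp hab).resolve_right fun h => he ?_
      rw [adj_edge] at h
      exact h.1.symm
    have hle : (G ⊔ edge u v) \ edge a b ≤ (G \ edge a b) ⊔ edge u v := by
      rw [sup_sdiff]
      exact sup_le_sup_left sdiff_le _
    have hle' : G \ edge a b ≤ G := sdiff_le
    have hlen : (p.mapLe hle).length = p.length := by simp
    rcases (p.mapLe hle).exists_of_sup_edge with ⟨q, hq⟩ | ⟨q, q', hq⟩ | ⟨q, q', hq⟩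
    · have := hG a b hGab q
      omega
    · have := huv ((q.mapLe hle').reverse.append (Walk.cons hGab (q'.mapLe hle').reverse))
      simp only [Walk.length_append, Walk.length_cons, Walk.length_reverse, Walk.length_map,
        Walk.mapLe] at this
      simp only [Walk.mapLe, Walk.length_map] at hq
      omega
    · have := huv ((q'.mapLe hle').append (Walk.cons hGab.symm (q.mapLe hle')))
      simp only [Walk.length_append, Walk.length_cons, Walk.length_map, Walk.mapLe] at this
      simp only [Walk.mapLe, Walk.length_map] at hq
      omega

/-- Removing an edge disconnects the path: no walk crosses the gap, so any `g` will do. -/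
theorem girthGE_pathGraph (n g : ℕ) : (pathGraph n).GirthGE g := by
  have key : ∀ (u v : Fin n), u.val + 1 = v.val → ∀ {a b : Fin n},
      (pathGraph n \ edge u v).Walk a b → (a ≤ u ↔ b ≤ u) := by
    intro u v huv a b p
    induction p with
    | nil => exact Iff.rfl
    | @cons a c b h p ih =>
      rw [← ih]
      rw [sdiff_adj, pathGraph_adj, edge_adj] at h
      obtain ⟨h1, h2⟩ := h
      simp only [Fin.ext_iff, Fin.le_def] at *
      omega
  intro u v huv p
  rcases pathGraph_adj.mp huv with h | h
  · have h1 := (key u v h p).mp le_rfl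
    rw [Fin.le_def] at h1
    omega
  · have h1 := (key v u h (p.reverse.mapLe (by rw [edge_comm]))).mp le_rfl
    rw [Fin.le_def] at h1
    omega

theorem pathGraph_sub_le_length {n : ℕ} {a b : Fin n} (p : (pathGraph n).Walk a b) :
    b.val ≤ a.val + p.length := by
  induction p with
  | nil => exact Nat.le_add_right _ _
  | cons h p ih =>
    rw [pathGraph_adj] at h
    rw [Walk.length_cons]
    omega

theorem girthGE_cycleGraph {n g : ℕ} (hg : g ≤ n + 1) : (cycleGraph (n + 1)).GirthGE g := by
  have h1 : (pathGraph (n + 1) ⊔ edge 0 (Fin.last n)).GirthGE g := by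
    refine (girthGE_pathGraph _ g).sup_edge fun p => ?_
    have := pathGraph_sub_le_length p
    simp only [Fin.val_last, Fin.val_zero] at this
    omega
  refine h1.anti fun u v huv => ?_
  have hne := huv.ne
  rw [cycleGraph_adj'] at huv
  rw [sup_adj, pathGraph_adj, edge_adj]
  simp only [ne_eq, Fin.ext_iff, Fin.val_last, Fin.val_zero] at *
  have key : ∀ u v : Fin (n + 1), (u - v).val = 1 → v.val + 1 = u.val ∨
      (u.val = 0 ∧ v.val = n) := by
    intro u v h
    have hu := u.2
    have hv := v.2
    rcases le_or_gt v u with hvu | hvu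
    · rw [Fin.sub_val_of_le hvu] at h
      omega
    · rw [Fin.coe_sub_iff_lt.mpr hvu] at h
      rw [Fin.lt_def] at hvu
      omega
  rcases huv with h | h
  · rcases key u v h with h | h <;> omega
  · rcases key v u h with h | h <;> omega

section Ball

variable [Fintype V] [DecidableEq V] (G : SimpleGraph V) [DecidableRel G.Adj]

/-- The vertices at distance at most `r` from `u`. -/
def walkBall : ℕ → V → Finset V
  | 0, u => {u}
  | r + 1, u => insert u ((G.neighborFinset u).biUnion (walkBall r))

theorem self_mem_walkBall (r : ℕ) (u : V) : u ∈ G.walkBall r u := by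
  cases r <;> simp [walkBall]

theorem mem_walkBall_of_walk {u v : V} (p : G.Walk u v) : ∀ {r : ℕ}, p.length ≤ r → v ∈ G.walkBall r u := by
  induction p with
  | nil => exact fun _ => G.self_mem_walkBall _ _
  | @cons a c b h p ih =>
    intro r hr
    rw [Walk.length_cons] at hr
    obtain ⟨r, rfl⟩ : ∃ r', r = r' + 1 := ⟨r - 1, by omega⟩
    exact mem_insert_of_mem (mem_biUnion.mpr
      ⟨c, (G.mem_neighborFinset a c).mpr h, ih (by omega)⟩)

theorem card_walkBall_le {d : ℕ} (hd : ∀ v, G.degree v ≤ d) : ∀ (r : ℕ) (u : V),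
    #(G.walkBall r u) ≤ (d + 1) ^ r := by
  intro r
  induction r with
  | zero => simp [walkBall]
  | succ r ih =>
    intro u
    have h1 : #((G.neighborFinset u).biUnion (G.walkBall r)) ≤ d * (d + 1) ^ r :=
      (card_biUnion_le_card_mul _ _ _ fun v _ => ih v).trans (Nat.mul_le_mul_right _ (hd u))
    have h2 := card_insert_le u ((G.neighborFinset u).biUnion (G.walkBall r))
    have h3 : 0 < (d + 1) ^ r := by positivity
    rw [walkBall, pow_succ]
    linarith

theorem degree_sup_edge_le {u v : V} {_ : DecidableRel (G ⊔ edge u v).Adj} (w : V) :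
    (G ⊔ edge u v).degree w ≤ G.degree w + if w = u ∨ w = v then 1 else 0 := by
  have hsub : (G ⊔ edge u v).neighborFinset w ⊆ G.neighborFinset w ∪
      if w = u then {v} else if w = v then {u} else ∅ := by
    intro x hx
    rw [mem_neighborFinset, sup_adj, edge_adj] at hx
    rw [mem_union, mem_neighborFinset]
    rcases hx with hx | ⟨⟨rfl, rfl⟩ | ⟨rfl, rfl⟩, hne⟩
    · exact Or.inl hx
    · simp
    · simp [hne]
  refine (card_le_card hsub).trans ((card_union_le _ _).trans ?_)
  rw [card_neighborFinset_eq_degree]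
  refine Nat.add_le_add_left ?_ _
  split_ifs <;> simp_all

end Ball

open Classical in
/-- The greedy construction of a graph of maximal degree 7 with large girth. -/
theorem exists_girthGE {n g b : ℕ} (hn : 3 ≤ n) (hg0 : 1 ≤ g) (hg : g ≤ n) (hb : 1 ≤ b)
    (h : 2 * b + 7 * 8 ^ g ≤ 5 * n) :
    ∃ G : SimpleGraph (Fin n), G.Connected ∧ (∀ v, 2 ≤ G.degree v) ∧ (∀ v, G.degree v ≤ 7) ∧
      G.GirthGE g ∧ #G.edgeFinset + 1 = n + b := by
  obtain ⟨n, rfl⟩ : ∃ m, n = m + 3 := ⟨n - 3, by omega⟩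
  let deg : SimpleGraph (Fin (n + 3)) → Fin (n + 3) → ℕ := fun G v => G.degree v
  let ecard : SimpleGraph (Fin (n + 3)) → ℕ := fun G => #G.edgeFinset
  have hsum : ∀ G, ∑ v, deg G v = 2 * ecard G := fun G => G.sum_degrees_eq_twice_card_edges
  have hcyc : ∀ v, deg (cycleGraph (n + 3)) v = 2 := fun v => by
    simp only [deg]
    convert cycleGraph_degree_three_le (v := v)
  -- Containing a Hamiltonian cycle ensures connectedness and degrees at least 2. The greedy process
  -- is replaced by a maximal element.
  let S : Set (SimpleGraph (Fin (n + 3))) := {G | cycleGraph (n + 3) ≤ G ∧ (∀ v, deg G v ≤ 7) ∧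
    G.GirthGE g ∧ ecard G + 1 ≤ n + 3 + b}
  have hne : S.Nonempty := by
    refine ⟨cycleGraph (n + 3), le_rfl, fun v => by rw [hcyc]; omega, girthGE_cycleGraph hg, ?_⟩
    have h1 := hsum (cycleGraph (n + 3))
    simp only [hcyc, sum_const, card_univ, Fintype.card_fin, smul_eq_mul] at h1
    omega
  obtain ⟨G, hG⟩ := (Set.toFinite S).exists_maximal hne
  obtain ⟨hGc, hGd, hGg, hGe⟩ := hG.prop
  refine ⟨G, cycleGraph_connected.mono hGc, fun v => ?_, hGd, hGg, ?_⟩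
  · rw [← hcyc v]
    refine card_le_card fun w hw => ?_
    rw [mem_neighborFinset] at hw ⊢
    exact hGc hw
  by_contra hlt
  change ¬ (ecard G + 1 = _) at hlt
  let low : Finset (Fin (n + 3)) := univ.filter fun v => deg G v < 7
  -- Two vertices of degree below 7 at distance greater than g could be joined, against maximality.
  -- So all such vertices lie in one ball of at most 8^g points.
  have hnear : ∀ u ∈ low, ∀ v ∈ low, v ∈ G.walkBall g u := by
    intro u hu v hv
    rw [mem_filter] at hu hv
    by_contra hfar
    have hne : u ≠ v := fun h => hfar (h ▸ G.self_mem_walkBall g u)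
    have hwalk : ∀ p : G.Walk u v, g < p.length := fun p =>
      not_le.mp fun hle => hfar (G.mem_walkBall_of_walk p hle)
    have huv : ¬ G.Adj u v := fun huv => by
      have := hwalk (Walk.cons huv Walk.nil)
      rw [Walk.length_cons, Walk.length_nil] at this
      omega
    have hmem : G ⊔ edge u v ∈ S := by
      refine ⟨hGc.trans le_sup_left, fun w => ?_, hGg.sup_edge fun p => ?_, ?_⟩
      · have h1 : deg (G ⊔ edge u v) w ≤ deg G w + if w = u ∨ w = v then 1 else 0 :=
          G.degree_sup_edge_le w
        split_ifs at h1 with hw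
        · rcases hw with rfl | rfl <;> omega
        · exact h1.trans (hGd w)
      · exact (hwalk p).le.trans (Nat.le_succ _)
      · have h2 : ecard (G ⊔ edge u v) = ecard G + 1 := by
          simp only [ecard]
          convert G.card_edgeFinset_sup_edge huv hne
        omega
    exact huv ((hG.le_of_ge hmem le_sup_left) (Or.inr ((edge_adj _ _ _ _).mpr
      ⟨Or.inl ⟨rfl, rfl⟩, hne⟩)))
  have hlow : #low ≤ 8 ^ g := by
    rcases low.eq_empty_or_nonempty with h0 | ⟨u, hu⟩
    · rw [h0]
      simp
    · exact (card_le_card fun v hv => hnear u hu v hv).trans (G.card_walkBall_le hGd g u)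
  have hdeg : 7 * (n + 3) ≤ ∑ v, deg G v + 7 * #low := by
    have h1 : ∑ v : Fin (n + 3), 7 ≤ ∑ v, (deg G v + if v ∈ low then 7 else 0) := by
      refine sum_le_sum fun v _ => ?_
      by_cases hv : v ∈ low
      · simp [hv]
      · rw [if_neg hv, add_zero]
        simpa [low] using hv
    rw [sum_add_distrib, sum_ite_mem, univ_inter] at h1
    simp only [sum_const, card_univ, Fintype.card_fin, smul_eq_mul] at h1
    omega
  -- If edges were missing, 7n ≤ 2·#edges + 7·8^g would give 5n < 2b + 7·8^g for the number n of
  -- vertices.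
  have := hsum G
  omega

end SimpleGraph

/-! ### Jacobians of graphs of large girth. -/

-- For an edge `e` of the support, the rest of the support must join its ends; a path there together
-- with `e` has at least `g` distinct edges.
open Multigraph in
theorem OrientedGraph.le_card_csupp (Γ : OrientedGraph) {g : ℕ} (hg : Γ.G.GirthGE g)
    {x : Γ.Edge → ℤ} (hx : x ∈ Γ.homology ℤ) (hx0 : x ≠ 0) : g ≤ (csupp x).card := by
  classical
  obtain ⟨e, he⟩ := Function.ne_iff.mp hx0
  let H : SimpleGraph Γ.V := SimpleGraph.fromEdgeSet {a | ∃ f : Γ.Edge, x f ≠ 0 ∧ f ≠ e ∧ f.1 = a}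
  let A : Finset Γ.V := Finset.univ.filter fun w => H.Reachable (Γ.tail e) w
  have hA : ∀ w, w ∈ A ↔ H.Reachable (Γ.tail e) w := fun w => by simp [A]
  have hends : ∀ f, x f ≠ 0 → f ≠ e → (Γ.head f ∈ A ↔ Γ.tail f ∈ A) := by
    intro f hf hfe
    have hadj : H.Adj (Γ.tail f) (Γ.head f) := by
      rw [SimpleGraph.fromEdgeSet_adj]
      exact ⟨⟨f, hf, hfe, Γ.edge_eq f⟩, Γ.tail_ne_head f⟩
    rw [hA, hA]
    exact ⟨fun h => h.trans hadj.symm.reachable, fun h => h.trans hadj.reachable⟩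
  -- Otherwise `e` is the only edge of the support leaving the component `A` of its tail, and
  -- summing the boundary over `A` gives x(e) = 0.
  have hhead : Γ.head e ∈ A := by
    by_contra hn
    have h1 : ∑ w ∈ A, Γ.boundary ℤ x w = 0 := by
      rw [LinearMap.mem_ker.mp hx]
      simp
    simp only [OrientedGraph.boundary_apply] at h1
    rw [Finset.sum_comm, Finset.sum_eq_single e] at h1
    · rw [← Finset.mul_sum, Finset.sum_sub_distrib, Finset.sum_ite_eq, Finset.sum_ite_eq,
        if_neg hn, if_pos ((hA _).mpr (SimpleGraph.Reachable.refl _))] at h1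
      simp only [zero_sub, mul_neg, mul_one, neg_eq_zero] at h1
      exact he h1
    · intro f _ hfe
      rw [← Finset.mul_sum, Finset.sum_sub_distrib, Finset.sum_ite_eq, Finset.sum_ite_eq]
      by_cases hf : x f = 0
      · rw [hf, zero_mul]
      · simp [hends f hf hfe]
    · exact fun h => (h (Finset.mem_univ e)).elim
  obtain ⟨q, hq⟩ := ((hA _).mp hhead).exists_isPath
  have hHle : H ≤ Γ.G \ SimpleGraph.edge (Γ.tail e) (Γ.head e) := by
    intro a b hab
    rw [SimpleGraph.fromEdgeSet_adj] at hab
    obtain ⟨⟨f, -, hfe, hf⟩, -⟩ := hab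
    rw [SimpleGraph.sdiff_adj, SimpleGraph.adj_edge]
    refine ⟨?_, fun h => hfe (Subtype.ext ?_)⟩
    · rw [← SimpleGraph.mem_edgeSet, ← hf]
      exact f.2
    · rw [hf, ← h.1, Γ.edge_eq e]
  have hadj : Γ.G.Adj (Γ.tail e) (Γ.head e) := by
    rw [← SimpleGraph.mem_edgeSet, ← Γ.edge_eq e]
    exact e.2
  have h1 := hg _ _ hadj (q.mapLe hHle)
  have h2 : q.length ≤ ((csupp x).erase e).card := by
    rw [← q.length_edges, ← List.toFinset_card_of_nodup hq.isTrail.edges_nodup,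
      ← Finset.card_image_of_injective _ (Subtype.val_injective (p := (· ∈ Γ.G.edgeSet)))]
    refine Finset.card_le_card fun a ha => ?_
    have h3 := q.edges_subset_edgeSet (List.mem_toFinset.mp ha)
    rw [SimpleGraph.edgeSet_fromEdgeSet] at h3
    obtain ⟨⟨f, hf, hfe, rfl⟩, -⟩ := h3
    exact Finset.mem_image_of_mem _ (Finset.mem_erase.mpr ⟨hfe, mem_csupp.mpr hf⟩)
  rw [Finset.card_erase_of_mem (mem_csupp.mpr he)] at h2
  have h3 : 0 < (csupp x).card := Finset.card_pos.mpr ⟨e, mem_csupp.mpr he⟩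
  have h4 : (q.mapLe hHle).length = q.length := by simp
  omega

open Classical in
/-- The unweighted graph associated with a simple graph. -/
noncomputable def WeightedGraph.ofSimpleGraph {n : ℕ} (G : SimpleGraph (Fin n)) (hc : G.Connected)
    (hd : ∀ v, 2 ≤ G.degree v) : WeightedGraph where
  V := Fin n
  G := G
  connected := hc
  two_le_degree := hd
  tail e := e.1.out.1
  head e := e.1.out.2
  edge_eq e := (Quot.out_eq e.1).symm
  w _ := 1
  w_nonneg _ := zero_le_one
  form_pos x _ hx := by
    obtain ⟨e, he⟩ := Function.ne_iff.mp hx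
    refine Finset.sum_pos' (fun e _ => ?_) ⟨e, Finset.mem_univ e, ?_⟩
    · rw [one_mul]
      exact mul_self_nonneg _
    · rw [one_mul]
      exact mul_self_pos.mpr he

open Multigraph in
theorem WeightedGraph.le_latticeMinNorm (Γ : WeightedGraph) (hw : ∀ e, Γ.w e = 1) {g : ℕ}
    (hg : Γ.G.GirthGE g) (hb : 1 ≤ Γ.betti) : (g : ℝ) ≤ latticeMinNorm Γ.jacobian := by
  refine le_csInf ?_ ?_
  -- A nonzero cycle is needed, since the infimum of the empty set would be 0.
  · have h1 : 0 < Module.finrank ℤ (Γ.homology ℤ) := by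
      rw [← Γ.betti_eq_finrank_int]
      exact hb
    have := Module.nontrivial_of_finrank_pos h1
    obtain ⟨z, hz⟩ := exists_ne (0 : Γ.homology ℤ)
    refine ⟨_, Γ.ofInt z, ?_, fun h0 => hz (Subtype.ext (funext fun e => ?_)), rfl⟩
    · rw [← Γ.range_ofInt]
      exact ⟨z, rfl⟩
    · have h2 := Γ.toChain_ofInt z e
      rw [h0, map_zero] at h2
      exact Int.cast_eq_zero.mp h2.symm
  · rintro r ⟨y, hy, hy0, rfl⟩
    rw [← Γ.range_ofInt] at hy
    obtain ⟨z, rfl⟩ := hy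
    have hz0 : (z : Γ.Edge → ℤ) ≠ 0 := fun h0 => hy0 (by
      rw [show z = 0 from Subtype.ext h0, map_zero])
    rw [Γ.inner_ofInt]
    calc (g : ℝ) ≤ (csupp (z : Γ.Edge → ℤ)).card :=
          Nat.cast_le.mpr (Γ.le_card_csupp hg z.2 hz0)
      _ = ∑ e, if (z : Γ.Edge → ℤ) e ≠ 0 then (1 : ℝ) else 0 := by
          rw [csupp, Finset.sum_boole]
      _ ≤ _ := by
          refine Finset.sum_le_sum fun e _ => ?_
          rw [hw, one_mul]
          split_ifs with h
          · have h3 : 1 ≤ (z : Γ.Edge → ℤ) e * (z : Γ.Edge → ℤ) e :=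
              Int.add_one_le_iff.mpr (mul_self_pos.mpr h)
            exact_mod_cast h3
          · exact mul_self_nonneg _

theorem exists_le_hermiteInvariant {n g b : ℕ} (hn : 3 ≤ n) (hg0 : 1 ≤ g) (hg : g ≤ n)
    (hb : 1 ≤ b) (h : 2 * b + 7 * 8 ^ g ≤ 5 * n) :
    ∃ r ∈ jacobianHermiteSet b, (g : ℝ) / (7 ^ (n - 1)) ^ (1 / (b : ℝ)) ≤ r := by
  classical
  obtain ⟨G, hc, hd2, hd7, hgirth, hcard⟩ := SimpleGraph.exists_girthGE hn hg0 hg hb h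
  let Γ := WeightedGraph.ofSimpleGraph G hc hd2
  have hV : Fintype.card Γ.V = n := Fintype.card_fin n
  have hE : Fintype.card Γ.Edge + 1 = n + b := by
    rw [← hcard, SimpleGraph.edgeFinset_card]
    congr!
  have hbetti : Γ.betti = b := by
    have := Γ.betti_add_card
    omega
  refine ⟨_, ⟨Γ, hbetti, rfl⟩, ?_⟩
  have h1 := Γ.le_latticeMinNorm (fun _ => rfl) hgirth (by omega)
  have h2 := Γ.latticeDet_jacobian_le (fun _ => rfl) (d := 7) (by norm_num) hd7
  rw [hV] at h2
  have h3 := Γ.latticeDet_jacobian_pos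
  have h4 : Module.finrank ℝ Γ.H1 = b := hbetti
  rw [hermiteInvariant, h4]
  refine div_le_div₀ (latticeMinNorm_nonneg _) h1 (Real.rpow_pos_of_pos h3 _) ?_
  exact Real.rpow_le_rpow h3.le (by exact_mod_cast h2) (by positivity)

/-! ### Asymptotic bounds. -/

theorem jacobianHermiteSet_nonempty {b : ℕ} (hb : 1 ≤ b) : (jacobianHermiteSet b).Nonempty := by
  obtain ⟨r, hr, -⟩ := exists_le_hermiteInvariant (n := b + 12) (g := 1) (by omega) le_rfl
    (by omega) hb (by omega)
  exact ⟨r, hr⟩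

theorem le_of_mem_jacobianHermiteSet {b : ℕ} (hb : 1 ≤ b) {r : ℝ} (hr : r ∈ jacobianHermiteSet b) :
    r ≤ (2 * Nat.log 2 b + 4 : ℕ) := by
  obtain ⟨Γ, rfl, rfl⟩ := hr
  exact Γ.hermiteInvariant_jacobian_le hb

theorem rho_le {b : ℕ} (hb : 1 ≤ b) : rho b ≤ 4 * Real.logb 2 (8 / 3 * (b : ℝ)) := by
  refine (csSup_le (jacobianHermiteSet_nonempty hb) fun r hr =>
    le_of_mem_jacobianHermiteSet hb hr).trans ?_
  have hb0 : (0 : ℝ) < b := by exact_mod_cast hb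
  have h1 : (Nat.log 2 b : ℝ) ≤ Real.logb 2 b := Real.natLog_le_logb b 2
  -- This absorbs the additive constant: 2 log₂ b + 4 ≤ 4 log₂ b + 4 log₂(8/3).
  have h2 : (1 : ℝ) ≤ Real.logb 2 (8 / 3) := by
    rw [Real.le_logb_iff_rpow_le one_lt_two (by norm_num)]
    norm_num
  have h3 : 0 ≤ (Nat.log 2 b : ℝ) := Nat.cast_nonneg _
  rw [Real.logb_mul (by norm_num) hb0.ne']
  push_cast
  linarith

theorem natLog_div_sqrt_le_rho {b : ℕ} (hb : 4096 ≤ b) :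
    (Nat.log 64 b : ℝ) / Real.sqrt 7 ≤ rho b := by
  set g := Nat.log 64 b with hgdef
  have hg2 : 2 ≤ g := Nat.le_log_of_pow_le (by norm_num) (by omega)
  have hgb : 64 ^ g ≤ b := Nat.pow_log_le_self 64 (by omega)
  have h64 : (64 : ℕ) ^ g = 8 ^ g * 8 ^ g := by rw [← mul_pow]; norm_num
  have h8 : 64 ≤ 8 ^ g := (Nat.pow_le_pow_right (by norm_num) hg2 : 8 ^ 2 ≤ 8 ^ g)
  have hgt : g < 8 ^ g := Nat.lt_pow_self (by norm_num)
  -- This makes 7·8^g small against b/2, as the choice n = ⌊b/2⌋ + 1 requires; that choice gives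
  -- 7^((n-1)/b) ≤ √7.
  have h9 : 64 * 8 ^ g ≤ b := (Nat.mul_le_mul_right _ h8).trans (h64 ▸ hgb)
  obtain ⟨r, hr, hgr⟩ := exists_le_hermiteInvariant (n := b / 2 + 1) (g := g) (b := b) (by omega)
    (by omega) (by omega) (by omega) (by omega)
  have hbdd : BddAbove (jacobianHermiteSet b) :=
    ⟨_, fun r hr => le_of_mem_jacobianHermiteSet (by omega) hr⟩
  refine le_trans ?_ (hgr.trans (le_csSup hbdd hr))
  have hb0 : (0 : ℝ) < b := by exact_mod_cast (by omega : 0 < b)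
  refine div_le_div_of_nonneg_left (Nat.cast_nonneg _) (by positivity) ?_
  rw [Real.sqrt_eq_rpow, ← Real.rpow_natCast, ← Real.rpow_mul (by norm_num), Nat.add_sub_cancel]
  refine Real.rpow_le_rpow_of_exponent_le (by norm_num) ?_
  have h10 : ((b / 2 : ℕ) : ℝ) ≤ b / 2 := Nat.cast_div_le
  rw [mul_one_div, div_le_iff₀ hb0]
  linarith

theorem eventually_le_rho :
    ∀ᶠ b : ℕ in atTop, 1 / (6 * Real.exp 1) * Real.logb 2 (b : ℝ) ≤ rho b := by
  have hlim : Tendsto (fun b : ℕ => Real.logb 2 (b : ℝ)) atTop atTop :=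
    (Real.tendsto_logb_atTop one_lt_two).comp tendsto_natCast_atTop_atTop
  -- Beyond log₂ b = 300 the gap between 2.65 > √7 and 2.718 < e outweighs the loss of 1 in rounding
  -- log₆₄ b.
  filter_upwards [eventually_ge_atTop 4096, hlim.eventually_ge_atTop 300] with b hb hL
  refine le_trans ?_ (natLog_div_sqrt_le_rho hb)
  have h1 : Real.logb 2 (b : ℝ) ≤ 6 * (Nat.log 64 b + 1) := by
    have h2 : b < 64 ^ (Nat.log 64 b + 1) := Nat.lt_pow_succ_log_self (by norm_num) b
    have h3 : (b : ℝ) ≤ (2 : ℝ) ^ (6 * (Nat.log 64 b + 1)) := by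
      rw [pow_mul]
      exact_mod_cast (show b ≤ (2 ^ 6) ^ (Nat.log 64 b + 1) from h2.le)
    have hb0 : (0 : ℝ) < b := by exact_mod_cast (by omega : 0 < b)
    rw [Real.logb_le_iff_le_rpow one_lt_two hb0]
    refine h3.trans_eq ?_
    rw [← Real.rpow_natCast]
    push_cast
    rfl
  have h7 : Real.sqrt 7 ≤ 2.65 := by
    rw [Real.sqrt_le_left (by norm_num)]
    norm_num
  have he : 2.718 ≤ Real.exp 1 := (by norm_num : (2.718 : ℝ) ≤ 2.7182818283).trans
    Real.exp_one_gt_d9.le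
  have hs : 0 < Real.sqrt 7 := by positivity
  calc 1 / (6 * Real.exp 1) * Real.logb 2 (b : ℝ) ≤ 1 / (6 * 2.718) * Real.logb 2 (b : ℝ) := by
        gcongr
    _ ≤ (Real.logb 2 (b : ℝ) / 6 - 1) / 2.65 := by
        rw [le_div_iff₀ (by norm_num)]
        linarith
    _ ≤ Nat.log 64 b / 2.65 := by
        gcongr
        linarith
    _ ≤ Nat.log 64 b / Real.sqrt 7 := by gcongr

theorem mainTheorem1 :
    (∀ b : ℕ, 1 ≤ b → (jacobianHermiteSet b).Nonempty ∧ BddAbove (jacobianHermiteSet b)) ∧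
    AsympLE (fun b => 1 / (6 * Real.exp 1) * Real.logb 2 (b : ℝ)) rho ∧
    AsympLE rho (fun b => 4 * Real.logb 2 (8 / 3 * (b : ℝ))) := by
  refine ⟨fun b hb => ⟨jacobianHermiteSet_nonempty hb,
    ⟨_, fun r hr => le_of_mem_jacobianHermiteSet hb hr⟩⟩, fun ε hε => ?_, fun ε hε => ?_⟩
  -- Both estimates hold without the factor 1 + ε; only the sign of the right-hand side remains to
  -- be checked.
  · filter_upwards [eventually_le_rho, eventually_ge_atTop 1] with b hb hb1
    have h1 : 0 ≤ 1 / (6 * Real.exp 1) * Real.logb 2 (b : ℝ) :=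
      mul_nonneg (by positivity) (Real.logb_nonneg one_lt_two (by exact_mod_cast hb1))
    have h2 := mul_nonneg hε.le (h1.trans hb)
    linarith
  · filter_upwards [eventually_ge_atTop 1] with b hb1
    have hb : (1 : ℝ) ≤ b := by exact_mod_cast hb1
    have h1 : 0 ≤ 4 * Real.logb 2 (8 / 3 * (b : ℝ)) :=
      mul_nonneg (by norm_num) (Real.logb_nonneg one_lt_two (by linarith))
    have h2 := mul_nonneg hε.le h1
    have h3 := rho_le hb1
    linarith
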